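/- **Conventions.** Fix $m\ge 0$. All rings are commutative and unital. A *differential ring* is a ring with $m$ commuting derivations $\delta_1,\dots,\delta_m$; a *differential field* is a field of characteristic $0$ with such derivations. A *differential $K$-algebra* is a $K$-algebra with $m$ commuting derivations extending those of $K$ (along the structure map); it is *differentially finitely generated* if it is generated as a $K$-algebra by all derivatives $\delta^\xi b=\delta_1^{\xi_1}\cdots\delta_m^{\xi_m}b$ of finitely many elements $b$. $K\{x\}=K[\delta^\xi x_i : \xi\in\mathbb N^m,\ 1\le i\le n]$ is the differential polynomial ring in $x=(x_1,\dots,x_n)$, and $K\{x\}_{\le r}$ is its subring of polynomials in the indeterminates $\delta^\xi x_i$ with $\sum_k\xi_k\le r$. The indeterminates are ordered by the lexicographic order of $(\sum_k\xi_k,\,i,\,\xi_1,\dots,\xi_m)$. For $f\in K\{x\}\setminus K$, the *leader* $v_f$ is the highest indeterminate occurring in $f$, $d_f=\deg_{v_f}f$, the *rank* of $f$ is $(v_f,d_f)$ (ranks are ordered lexicographically), the *initial* $I_f$ is the coefficient of $v_f^{d_f}$ in $f$, and the *separant* is $S_f=\partial f/\partial v_f$. We say $g$ is *reduced* with respect to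 $f$ if no proper derivative of $v_f$ occurs in $g$ and $\deg_{v_f}g<d_f$. A set $\Lambda\subseteq K\{x\}\setminus K$ is *autoreduced* if each of its elements is reduced with respect to every other one; such sets are finite and are listed by nondecreasing rank, and $\{g_1,\dots,g_s\}<\{f_1,\dots,f_t\}$ means that either for some $i\le s,t$ one has $\mathrm{rk}\,g_j=\mathrm{rk}\,f_j$ for $j<i$ and $\mathrm{rk}\,g_i<\mathrm{rk}\,f_i$, or $s>t$ and $\mathrm{rk}\,g_j=\mathrm{rk}\,f_j$ for $j\le t$. A *characteristic set* of a prime differential ideal $P$ is a minimal autoreduced subset of $P$. Put $H_\Lambda=\prod_{f\in\Lambda}I_fS_f$, let $\Lambda^{(r)}$ be the set of all $\delta^\xi f$ of order at most $r$ with $f\in\Lambda$, let $(\Lambda^{(r)})$ be the ideal it generates in $K\{x\}_{\le r}$, and $I:h^\infty=\{f : h^\ell f\in I\text{ for some }\ell\ge0\}$. **Theorem.** Let $K$ be a differential field. 1. Let $B$ be a differentially finitely generated differential $K$-algebra that is a domain. Then there are a finitely generated $K$-subalgebra $A\subseteq B$ (in particular a domain), an element $0\ne h\in A$, and a polynomial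 $K$-algebra $P$ (in some set of indeterminates, possibly infinite) such that $B_h\cong A_h\otimes_K P$ as $K$-algebras, by an isomorphism sending $a/1$ to $(a/1)\otimes 1$ for $a\in A$. 2. Let $\Lambda$ be a characteristic set of a prime differential ideal $P\subseteq K\{x\}$, and let $r\ge0$ be such that $\Lambda\subseteq K\{x\}_{\le r}$. Put $S=K\{x\}/P$ and $R=K\{x\}_{\le r}/\big((\Lambda^{(r)}):H_\Lambda^\infty\big)$, and write $h$ for the class of $H_\Lambda$ in $R$ and in $S$. Then: - the inclusion $K\{x\}_{\le r}\subseteq K\{x\}$ induces a homomorphism $R_h\to S_h$ which makes $S_h$ a polynomial algebra over $R_h$; - $R$ is a domain, the inclusion also induces an embedding $\mathrm{Frac}(R)\to\mathrm{Frac}(S)$, and $\mathrm{Frac}(R)$ is existentially closed in $\mathrm{Frac}(S)$ as a field, i.e. every algebraic variety over $\mathrm{Frac}(R)$ with a $\mathrm{Frac}(S)$-point has a $\mathrm{Frac}(R)$-point. -/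

import Mathlib

open scoped TensorProduct

universe u v

noncomputable section

namespace DiffAlg

/-! ### Differential rings, algebras and ideals -/

/-- A commutative ring with `m` commuting derivations. -/
class DiffRing (m : ℕ) (R : Type*) [CommRing R] where
  /-- the distinguished derivations -/
  der : Fin m → Derivation ℤ R R
  der_comm : ∀ (i j : Fin m) (a : R), der i (der j a) = der j (der i a)

/-- The structure map `K → B` commutes with the distinguished derivations. -/
class DiffAlgebra (m : ℕ) (K B : Type*) [CommRing K] [CommRing B] [Algebra K B]
    [DiffRing m K] [DiffRing m B] : Prop where
  der_algebraMap : ∀ (k : Fin m) (a : K),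
    DiffRing.der k (algebraMap K B a) = algebraMap K B (DiffRing.der k a)

/-- The operator `δ^ξ = δ₁^ξ₁ ⋯ δₘ^ξₘ`. -/
def iterDer {m : ℕ} {R : Type*} [CommRing R] [DiffRing m R] (ξ : Fin m → ℕ) :
    Module.End ℤ R :=
  (List.ofFn fun k : Fin m =>
    ((DiffRing.der k : Derivation ℤ R R).toLinearMap : Module.End ℤ R) ^ ξ k).prod

/-- `B` is generated as a `K`-algebra by all the derivatives `δ^ξ b` of finitely many elements. -/
def DiffFinGen (m : ℕ) (K B : Type*) [CommRing K] [CommRing B] [Algebra K B]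
    [DiffRing m B] : Prop :=
  ∃ s : Finset B, Algebra.adjoin K {c : B | ∃ ξ : Fin m → ℕ, ∃ b ∈ s, c = iterDer ξ b} = ⊤

/-- Ideals stable under the distinguished derivations. -/
def IsDiffIdeal (m : ℕ) {R : Type*} [CommRing R] [DiffRing m R] (I : Ideal R) : Prop :=
  ∀ (k : Fin m), ∀ f ∈ I, DiffRing.der k f ∈ I

/-! ### Differential polynomials -/

/-- The algebraic indeterminate `δ^ξ x_i`, with `ξ = exp` and `i = idx`. -/
@[ext]
structure DVar (m n : ℕ) where
  /-- the multi-index `ξ` -/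
  exp : Fin m → ℕ
  /-- the index `i` -/
  idx : Fin n

/-- The order `∑ ξ_k` of `δ^ξ x_i`. -/
def DVar.order {m n : ℕ} (v : DVar m n) : ℕ := ∑ k, v.exp k

/-- The tuple `(∑ ξ_k, i, ξ₁, …, ξₘ)`, in a lexicographically ordered type. -/
def DVar.key {m n : ℕ} (v : DVar m n) : ℕ ×ₗ (Fin n ×ₗ Lex (Fin m → ℕ)) :=
  toLex (v.order, toLex (v.idx, toLex v.exp))

theorem DVar.key_injective {m n : ℕ} : Function.Injective (DVar.key (m := m) (n := n)) := by
  intro v w h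
  have h1 := congrArg (fun z => (ofLex (ofLex z).2)) h
  have h2 : (v.idx, toLex v.exp) = (w.idx, toLex w.exp) := h1
  rw [Prod.mk.injEq] at h2
  exact DVar.ext (toLex.injective h2.2) h2.1

/-- The canonical orderly ranking. -/
instance {m n : ℕ} : LinearOrder (DVar m n) :=
  LinearOrder.lift' DVar.key DVar.key_injective

/-- `δ_k` applied to the indeterminate `δ^ξ x_i`. -/
def DVar.shift {m n : ℕ} (k : Fin m) (v : DVar m n) : DVar m n :=
  ⟨v.exp + Pi.single k 1, v.idx⟩

/-- `w` is a proper derivative of `v`. -/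
def DVar.IsProperDerivative {m n : ℕ} (w v : DVar m n) : Prop :=
  w.idx = v.idx ∧ v.exp < w.exp

/-- The differential polynomial ring `K{x₁, …, xₙ}`. -/
abbrev DiffPoly (m n : ℕ) (K : Type*) [CommRing K] := MvPolynomial (DVar m n) K

/-- A derivation of `K` applied to the coefficients of polynomials over `K`. -/
def coeffDer {σ K : Type*} [CommRing K] (d : Derivation ℤ K K) :
    Derivation ℤ (MvPolynomial σ K) (MvPolynomial σ K) :=
  Derivation.mk'
    (AddMonoidHom.toIntLinearMap
      ({ toFun := fun p => AddMonoidAlgebra.ofCoeff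
          ((AddMonoidAlgebra.coeff p).mapRange d d.map_zero)
         map_zero' := by
          ext s
          simp [MvPolynomial.coeff]
         map_add' := fun p q => by
          ext s
          simp [MvPolynomial.coeff] } : MvPolynomial σ K →+ MvPolynomial σ K))
    (by
      have key : ∀ (s : σ →₀ ℕ) (a : K), (AddMonoidAlgebra.ofCoeff
          ((AddMonoidAlgebra.coeff (MvPolynomial.monomial s a)).mapRange d d.map_zero) :
            MvPolynomial σ K) = MvPolynomial.monomial s (d a) := by
        intro s a
        ext t
        simp [MvPolynomial.monomial, MvPolynomial.coeff]
      intro p q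
      induction p using MvPolynomial.induction_on' with
      | add p p' hp hp' =>
        rw [add_mul, map_add, hp, hp', map_add]; simp only [smul_eq_mul]; ring
      | monomial s a =>
        induction q using MvPolynomial.induction_on' with
        | add q q' hq hq' =>
          rw [mul_add, map_add, hq, hq', map_add]; simp only [smul_eq_mul]; ring
        | monomial t b =>
          rw [MvPolynomial.monomial_mul]
          simp only [AddMonoidHom.coe_toIntLinearMap, AddMonoidHom.coe_mk, ZeroHom.coe_mk, key, smul_eq_mul, MvPolynomial.monomial_mul,
            Derivation.leibniz, map_add]
          rw [add_comm t s, mul_comm b])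

theorem coeffDer_monomial {σ K : Type*} [CommRing K] (d : Derivation ℤ K K) (s : σ →₀ ℕ) (a : K) :
    coeffDer d (MvPolynomial.monomial s a) = MvPolynomial.monomial s (d a) := by
  ext t
  simp [coeffDer, MvPolynomial.monomial, MvPolynomial.coeff]

/-- The derivation of `K{x}` extending `δ_k` on `K` with `δ^ξ x_i ↦ δ_k δ^ξ x_i`. -/
def polyDer {m n : ℕ} {K : Type*} [CommRing K] [DiffRing m K] (k : Fin m) :
    Derivation ℤ (DiffPoly m n K) (DiffPoly m n K) :=
  coeffDer (DiffRing.der k) +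
    (MvPolynomial.mkDerivation K fun v : DVar m n =>
      (MvPolynomial.X (v.shift k) : DiffPoly m n K)).restrictScalars ℤ

theorem polyDer_C {m n : ℕ} {K : Type*} [CommRing K] [DiffRing m K] (k : Fin m) (a : K) :
    polyDer k (MvPolynomial.C a : DiffPoly m n K) = MvPolynomial.C (DiffRing.der k a) := by
  have := coeffDer_monomial (σ := DVar m n) (DiffRing.der k) 0 a
  simpa [polyDer] using this

theorem polyDer_X {m n : ℕ} {K : Type*} [CommRing K] [DiffRing m K] (k : Fin m) (v : DVar m n) :
    polyDer k (MvPolynomial.X v : DiffPoly m n K) = MvPolynomial.X (v.shift k) := by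
  have := coeffDer_monomial (K := K) (DiffRing.der k) (Finsupp.single v 1) 1
  rw [Derivation.map_one_eq_zero, map_zero] at this
  have h2 := MvPolynomial.mkDerivation_X (R := K)
    (fun w : DVar m n => (MvPolynomial.X (w.shift k) : DiffPoly m n K)) v
  rw [polyDer, Derivation.add_apply, Derivation.restrictScalars_apply, h2]
  rw [show coeffDer (DiffRing.der k) (MvPolynomial.X v : DiffPoly m n K) = 0 from this, zero_add]

instance {m n : ℕ} {K : Type*} [CommRing K] [DiffRing m K] : DiffRing m (DiffPoly m n K) where
  der := polyDer
  der_comm i j f := by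
    have h : ∀ g : DiffPoly m n K,
        ⁅(polyDer i : Derivation ℤ (DiffPoly m n K) (DiffPoly m n K)), polyDer j⁆ g = 0 := by
      intro g
      induction g using MvPolynomial.induction_on with
      | C a =>
        rw [Derivation.commutator_apply, polyDer_C, polyDer_C, polyDer_C, polyDer_C,
          DiffRing.der_comm, sub_self]
      | add p q hp hq => rw [map_add, hp, hq, add_zero]
      | mul_X p v hp =>
        rw [Derivation.leibniz, hp, smul_zero, add_zero, Derivation.commutator_apply,
          polyDer_X, polyDer_X, polyDer_X, polyDer_X]
        simp [DVar.shift, add_right_comm]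
    have := h f
    rwa [Derivation.commutator_apply, sub_eq_zero] at this

instance {m n : ℕ} {K : Type*} [CommRing K] [DiffRing m K] : DiffAlgebra m K (DiffPoly m n K) where
  der_algebraMap k a := polyDer_C k a

/-- `K{x}_{≤ r}`, the differential polynomials of order at most `r`. -/
def orderLE (m n : ℕ) (K : Type*) [CommRing K] (r : ℕ) : Subalgebra K (DiffPoly m n K) :=
  MvPolynomial.supported K {v : DVar m n | v.order ≤ r}

/-! ### Leaders, ranks, initials and separants -/

section Rank

variable {m n : ℕ} {K : Type*} [CommRing K]

/-- The leader of `f`: the highest ranking indeterminate in `f` (`⊥` if `f` is constant). -/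
def leader (f : DiffPoly m n K) : WithBot (DVar m n) := f.vars.max

/-- The degree of `f` in its leader (`0` if `f` is constant). -/
def leadDeg (f : DiffPoly m n K) : ℕ :=
  if h : f.vars.Nonempty then MvPolynomial.degreeOf (f.vars.max' h) f else 0

/-- The rank `(v_f, d_f)`; ranks are ordered lexicographically. -/
def rank (f : DiffPoly m n K) : WithBot (DVar m n) ×ₗ ℕ := toLex (leader f, leadDeg f)

/-- The coefficient of `v ^ d` in `f`, where `d` is the degree of `f` in `v`. -/
def leadCoeffAt (v : DVar m n) (f : DiffPoly m n K) : DiffPoly m n K :=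
  ∑ s ∈ f.support with s v = MvPolynomial.degreeOf v f,
    MvPolynomial.monomial (s.erase v) (MvPolynomial.coeff s f)

/-- The initial `I_f` of a nonconstant `f`. -/
def initial (f : DiffPoly m n K) : DiffPoly m n K :=
  if h : f.vars.Nonempty then leadCoeffAt (f.vars.max' h) f else 1

/-- The separant `S_f` of a nonconstant `f`. -/
def separant (f : DiffPoly m n K) : DiffPoly m n K :=
  if h : f.vars.Nonempty then MvPolynomial.pderiv (f.vars.max' h) f else 1

/-- `H_Λ = ∏_{f ∈ Λ} I_f S_f`. -/
def HProd (Λ : Finset (DiffPoly m n K)) : DiffPoly m n K := ∏ f ∈ Λ, initial f * separant f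

/-! ### Autoreduced and characteristic sets -/

/-- `g` is reduced with respect to the nonconstant `f`: no proper derivative of `v_f` occurs in
`g`, and the degree of `g` in `v_f` is less than `d_f`. -/
def IsReduced (g f : DiffPoly m n K) : Prop :=
  ∃ v : DVar m n, leader f = v ∧ (∀ w ∈ g.vars, ¬ w.IsProperDerivative v) ∧
    MvPolynomial.degreeOf v g < MvPolynomial.degreeOf v f

/-- A (finite) autoreduced set: its elements are nonconstant, and each one is reduced with respect
to every other one. -/
def IsAutoreduced (Λ : Finset (DiffPoly m n K)) : Prop :=
  (∀ f ∈ Λ, f.vars.Nonempty) ∧ ∀ f ∈ Λ, ∀ g ∈ Λ, g ≠ f → IsReduced g f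

/-- The ranks of the elements of `Λ`, in nondecreasing order. -/
def rankList (Λ : Finset (DiffPoly m n K)) : List (WithBot (DVar m n) ×ₗ ℕ) :=
  (Λ.val.map rank).sort (· ≤ ·)

/-- `Γ < Λ` in the ranking of autoreduced sets: at the first place where the lists of ranks differ
`Γ` has the lower rank, or else the list of `Λ` is a proper initial segment of that of `Γ`. -/
def RanksLower (Γ Λ : Finset (DiffPoly m n K)) : Prop :=
  (∃ (i : ℕ) (a b : WithBot (DVar m n) ×ₗ ℕ),
      (rankList Γ)[i]? = some a ∧ (rankList Λ)[i]? = some b ∧ a < b ∧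
      ∀ j < i, (rankList Γ)[j]? = (rankList Λ)[j]?) ∨
    ((rankList Λ).length < (rankList Γ).length ∧
      ∀ j < (rankList Λ).length, (rankList Γ)[j]? = (rankList Λ)[j]?)

/-- `Λ` is a characteristic set of `P`: a minimal autoreduced subset of `P`. -/
def IsCharSet (Λ : Finset (DiffPoly m n K)) (P : Ideal (DiffPoly m n K)) : Prop :=
  IsAutoreduced Λ ∧ (∀ f ∈ Λ, f ∈ P) ∧
    ∀ Γ : Finset (DiffPoly m n K), IsAutoreduced Γ → (∀ f ∈ Γ, f ∈ P) → ¬ RanksLower Γ Λ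

/-! ### The truncated quotient -/

theorem leadCoeffAt_mem {r : ℕ} (v : DVar m n) {f : DiffPoly m n K} (hf : f ∈ orderLE m n K r) :
    leadCoeffAt v f ∈ orderLE m n K r := by
  refine Subalgebra.sum_mem _ fun s hs => ?_
  rw [orderLE, MvPolynomial.mem_supported] at hf ⊢
  intro w hw
  apply hf
  have hw' := MvPolynomial.mem_vars_iff_mem_support _ |>.1 (Finset.mem_coe.1 hw)
  obtain ⟨t, ht, hwt⟩ := hw'
  have hts : t = s.erase v := by
    have := MvPolynomial.support_monomial_subset ht
    simpa using this
  rw [Finset.mem_coe, MvPolynomial.mem_vars_iff_mem_support]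
  refine ⟨s, (Finset.mem_filter.1 hs).1, ?_⟩
  rw [hts, Finsupp.support_erase] at hwt
  exact Finset.mem_of_mem_erase hwt

theorem pderiv_mem {r : ℕ} (v : DVar m n) {f : DiffPoly m n K} (hf : f ∈ orderLE m n K r) :
    MvPolynomial.pderiv v f ∈ orderLE m n K r := by
  rw [orderLE, MvPolynomial.supported] at hf
  induction hf using Algebra.adjoin_induction with
  | mem x hx =>
    obtain ⟨w, hw, rfl⟩ := hx
    rw [MvPolynomial.pderiv_X]
    by_cases h : w = v
    · subst h; simp
    · simp [Ne.symm h]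
  | algebraMap a =>
    rw [MvPolynomial.algebraMap_eq, MvPolynomial.pderiv_C]; exact Subalgebra.zero_mem _
  | add p q _ _ hp hq => rw [map_add]; exact Subalgebra.add_mem _ hp hq
  | mul p q hp' hq' hp hq =>
    rw [Derivation.leibniz]
    exact Subalgebra.add_mem _ (Subalgebra.mul_mem _ hp' hq) (Subalgebra.mul_mem _ hq' hp)

theorem HProd_mem {r : ℕ} {Λ : Finset (DiffPoly m n K)} (hΛ : ∀ f ∈ Λ, f ∈ orderLE m n K r) :
    HProd Λ ∈ orderLE m n K r := by
  refine Subalgebra.prod_mem _ fun f hf => Subalgebra.mul_mem _ ?_ ?_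
  · unfold initial; split
    · exact leadCoeffAt_mem _ (hΛ f hf)
    · exact Subalgebra.one_mem _
  · unfold separant; split
    · exact pderiv_mem _ (hΛ f hf)
    · exact Subalgebra.one_mem _

end Rank

/-- The saturation `I : h^∞`. -/
def saturation {R : Type*} [CommRing R] (I : Ideal R) (h : R) : Ideal R where
  carrier := {f | ∃ l : ℕ, h ^ l * f ∈ I}
  zero_mem' := ⟨0, by simp⟩
  add_mem' := by
    rintro a b ⟨k, hk⟩ ⟨l, hl⟩
    refine ⟨k + l, ?_⟩
    have : h ^ (k + l) * (a + b) = h ^ l * (h ^ k * a) + h ^ k * (h ^ l * b) := by ring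
    rw [this]
    exact I.add_mem (I.mul_mem_left _ hk) (I.mul_mem_left _ hl)
  smul_mem' := by
    rintro c a ⟨k, hk⟩
    refine ⟨k, ?_⟩
    have : h ^ k * (c • a) = c * (h ^ k * a) := by rw [smul_eq_mul]; ring
    rw [this]
    exact I.mul_mem_left _ hk

section Trunc

variable {m n : ℕ} {K : Type*} [CommRing K] [DiffRing m K]

/-- `(Λ^{(r)})`: the ideal of `K{x}_{≤ r}` generated by those derivatives `δ^ξ f` of elements
`f ∈ Λ` which have order at most `r`. -/
def truncIdeal (Λ : Finset (DiffPoly m n K)) (r : ℕ) : Ideal (orderLE m n K r) :=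
  Ideal.span {g | ∃ ξ : Fin m → ℕ, ∃ f ∈ Λ, (g : DiffPoly m n K) = iterDer ξ f}

/-- `H_Λ` as an element of `K{x}_{≤ r}`. -/
def HTrunc (Λ : Finset (DiffPoly m n K)) (r : ℕ) (hΛ : ∀ f ∈ Λ, f ∈ orderLE m n K r) :
    orderLE m n K r := ⟨HProd Λ, HProd_mem hΛ⟩

/-- The truncated quotient `K{x}_{≤ r} / (Λ^{(r)}) : H_Λ^∞`. -/
abbrev TruncQuot (Λ : Finset (DiffPoly m n K)) (r : ℕ) (hΛ : ∀ f ∈ Λ, f ∈ orderLE m n K r) :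
    Type _ :=
  orderLE m n K r ⧸ saturation (truncIdeal Λ r) (HTrunc Λ r hΛ)

/-- The quotient map onto the truncated quotient. -/
abbrev truncMk (Λ : Finset (DiffPoly m n K)) (r : ℕ) (hΛ : ∀ f ∈ Λ, f ∈ orderLE m n K r) :
    orderLE m n K r →+* TruncQuot Λ r hΛ :=
  Ideal.Quotient.mk (saturation (truncIdeal Λ r) (HTrunc Λ r hΛ))

end Trunc

/-! ### Existentially closed field extensions -/

/-- `F` is existentially closed in `L` along `φ : F → L`: every affine variety over `F` with an
`L`-point has an `F`-point. (Any variety is covered by affine ones, so this is the same as asking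
it of all varieties.) -/
def IsExistentiallyClosed {F L : Type*} [Field F] [Field L] (φ : F →+* L) : Prop :=
  ∀ (N : ℕ) (E : Set (MvPolynomial (Fin N) F)),
    (∃ a : Fin N → L, ∀ p ∈ E, MvPolynomial.eval₂ φ a p = 0) →
      ∃ a : Fin N → F, ∀ p ∈ E, MvPolynomial.eval a p = 0

end DiffAlg

end

noncomputable section

namespace DiffAlg

open MvPolynomial

/-! ### Derivatives of indeterminates -/

section DVar

variable {m n : ℕ}

/-! Let `Λ` be an autoreduced subset of `P` such that no nonzero element of `P` is reduced with
respect to all of `Λ` (`IsReducing`). A characteristic set has this property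
(`IsCharSet.isReducing`). When no `Λ` is given, as for an algebra `B = K{x}/P`, one is built
directly (`exists_isReducing`). Initials and separants of elements of `Λ` are nonzero and reduced,
the separants because of characteristic 0, so `H_Λ ∉ P` (`IsReducing.HProd_notMem`).

For `ξ ≠ 0` the derivative `δ^ξ f` equals `S_f · δ^ξ v_f` plus terms in lower indeterminates. Once
`H_Λ` is inverted, every proper derivative of a leader is therefore, modulo `P`, a polynomial in
lower indeterminates. Hence `S_h` is generated over the image of `K{x}_{≤ r}` by the indeterminates
of order greater than `r` that are not derivatives of leaders
(`IsReducing.exists_freePoly_sub_mem`).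

These free indeterminates are algebraically independent over that image. The ranking is orderly, so
a polynomial in them over `K{x}_{≤ r}` is reduced using only derivatives of `Λ` of order at most
`r`. If it lies in `P`, its remainder is `0`, so a power of `H_Λ` carries it into the ideal
generated by `Λ^{(r)}`. Comparing coefficients puts each coefficient in the saturation of
`(Λ^{(r)})` (`IsReducing.coeff_mem_saturation`), which is `P ∩ K{x}_{≤ r}`
(`IsReducing.saturation_eq`).

Thus `Frac S` is a rational function field over `Frac R`, which is infinite. A point with rational
function coordinates specialises to a rational point wherever the denominators do not vanish
(`isExistentiallyClosed_of_polynomial`). -/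

theorem DVar.lt_iff_key {v w : DVar m n} : v < w ↔ v.key < w.key := Iff.rfl

instance : WellFoundedLT (DVar m n) :=
  ⟨InvImage.wf DVar.key (wellFounded_lt (α := ℕ ×ₗ (Fin n ×ₗ Lex (Fin m → ℕ))))⟩

/-- The derivative `δ^ξ v` of the indeterminate `v`. -/
def DVar.add (v : DVar m n) (ξ : Fin m → ℕ) : DVar m n := ⟨v.exp + ξ, v.idx⟩

theorem DVar.order_add (v : DVar m n) (ξ : Fin m → ℕ) : (v.add ξ).order = v.order + ∑ k, ξ k := by
  simp [DVar.order, DVar.add, Finset.sum_add_distrib]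

theorem DVar.shift_eq_add (v : DVar m n) (k : Fin m) : v.shift k = v.add (Pi.single k 1) := rfl

theorem DVar.add_shift (v : DVar m n) (ξ : Fin m → ℕ) (k : Fin m) :
    (v.add ξ).shift k = v.add (ξ + Pi.single k 1) := by
  simp [DVar.add, DVar.shift, add_assoc]

theorem DVar.order_le_of_le {v w : DVar m n} (h : v ≤ w) : v.order ≤ w.order := by
  rcases h.lt_or_eq with h | rfl
  · rw [DVar.lt_iff_key, Prod.Lex.lt_iff] at h
    rcases h with h | h
    · exact h.le
    · exact h.1.le
  · exact le_rfl

theorem DVar.lt_of_order_lt {v w : DVar m n} (h : v.order < w.order) : v < w := by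
  rw [DVar.lt_iff_key, Prod.Lex.lt_iff]; exact Or.inl h

theorem DVar.lt_shift (v : DVar m n) (k : Fin m) : v < v.shift k :=
  DVar.lt_of_order_lt (by rw [DVar.shift_eq_add, DVar.order_add]; simp)

/-- Applying `δ_k` adds the same unit to the order and to the `k`-th exponent of both
indeterminates, so the first place where their keys differ stays the same. -/
theorem DVar.shift_strictMono (k : Fin m) : StrictMono (DVar.shift (n := n) k) := by
  intro v w h
  rw [DVar.lt_iff_key, Prod.Lex.lt_iff] at h ⊢
  rcases h with h | ⟨h, h'⟩
  · left
    change (v.shift k).order < (w.shift k).order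
    rw [DVar.shift_eq_add, DVar.shift_eq_add, DVar.order_add, DVar.order_add]
    exact Nat.add_lt_add_right h _
  · right
    refine ⟨?_, ?_⟩
    · change (v.shift k).order = (w.shift k).order
      rw [DVar.shift_eq_add, DVar.shift_eq_add, DVar.order_add, DVar.order_add]
      exact congrArg (· + _) h
    · rw [Prod.Lex.lt_iff] at h' ⊢
      rcases h' with h' | ⟨h', i, hi, hi'⟩
      · exact Or.inl h'
      · refine Or.inr ⟨h', i, fun j hj => ?_, ?_⟩
        · exact congrArg (· + (Pi.single k 1 : Fin m → ℕ) j) (hi j hj)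
        · exact Nat.add_lt_add_right hi' ((Pi.single k 1 : Fin m → ℕ) i)

theorem DVar.isProperDerivative_iff {w v : DVar m n} :
    w.IsProperDerivative v ↔ ∃ ξ : Fin m → ℕ, ξ ≠ 0 ∧ w = v.add ξ := by
  constructor
  · rintro ⟨hi, hlt⟩
    refine ⟨w.exp - v.exp, fun h => ?_, ?_⟩
    · exact hlt.not_ge (tsub_eq_zero_iff_le.1 h)
    · ext1
      · exact (add_tsub_cancel_of_le hlt.le).symm
      · exact hi
  · rintro ⟨ξ, hξ, rfl⟩
    exact ⟨rfl, lt_add_of_pos_right _ (pos_iff_ne_zero.2 hξ)⟩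

theorem DVar.IsProperDerivative.lt {w v : DVar m n} (h : w.IsProperDerivative v) : v < w := by
  obtain ⟨ξ, hξ, rfl⟩ := DVar.isProperDerivative_iff.1 h
  apply DVar.lt_of_order_lt
  rw [DVar.order_add, Nat.lt_add_right_iff_pos, Nat.pos_iff_ne_zero]
  intro h0
  exact hξ (funext fun k => (Finset.sum_eq_zero_iff.1 h0) k (Finset.mem_univ k))

theorem DVar.finite_order_le (r : ℕ) : {v : DVar m n | v.order ≤ r}.Finite := by
  have hinj : Function.Injective fun v : DVar m n => (v.exp, v.idx) := by
    rintro ⟨a, b⟩ ⟨c, d⟩ h; simpa using h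
  refine Set.Finite.of_finite_image (f := fun v : DVar m n => (v.exp, v.idx)) ?_ hinj.injOn
  refine (((Set.finite_Iic (fun _ : Fin m => r)).prod (Set.finite_univ (α := Fin n)))).subset ?_
  rintro _ ⟨v, hv, rfl⟩
  refine ⟨fun k => ?_, Set.mem_univ _⟩
  exact (Finset.single_le_sum (f := v.exp) (fun _ _ => Nat.zero_le _) (Finset.mem_univ k)).trans hv

/-- Dickson's lemma. -/
theorem DVar.finite_of_not_isProperDerivative (s : Set (DVar m n))
    (h : ∀ v ∈ s, ∀ w ∈ s, ¬ w.IsProperDerivative v) : s.Finite := by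
  by_contra hs
  have := Set.infinite_coe_iff.2 hs
  let e := Infinite.natEmbedding s
  -- Componentwise order on exponents together with equality of indices is a well-quasi-order, so an
  -- infinite sequence has two comparable terms; being distinct, they have different exponents.
  obtain ⟨a, b, hab, hle⟩ := wellQuasiOrdered_le (α := Fin m → ℕ) |>.prod
    (Finite.wellQuasiOrdered (Eq : Fin n → Fin n → Prop))
      (fun k => ((e k : DVar m n).exp, (e k : DVar m n).idx))
  refine h _ (e a).2 _ (e b).2 ⟨hle.2.symm, lt_of_le_of_ne hle.1 fun heq => hab.ne (e.injective ?_)⟩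
  exact Subtype.ext (DVar.ext heq hle.2)

end DVar

/-! ### Iterated derivations -/

section IterDer

variable {m : ℕ} {R : Type*} [CommRing R] [DiffRing m R]

/-- The multi-index `ξ` spelled out as a word in the derivations. -/
def derWord (ξ : Fin m → ℕ) : List (Fin m) :=
  (List.ofFn fun k => List.replicate (ξ k) k).flatten

theorem sum_derWord (ξ : Fin m → ℕ) :
    ((derWord ξ).map fun k => (Pi.single k 1 : Fin m → ℕ)).sum = ξ := by
  rw [derWord, List.map_flatten, List.sum_flatten, List.map_ofFn, List.map_ofFn, List.sum_ofFn]
  funext j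
  simp [Finset.sum_apply, Pi.single_apply]

theorem iterDer_eq_prod_derWord (ξ : Fin m → ℕ) :
    (iterDer ξ : Module.End ℤ R) =
      ((derWord ξ).map fun k => ((DiffRing.der k : Derivation ℤ R R).toLinearMap :
        Module.End ℤ R)).prod := by
  rw [derWord, List.map_flatten, List.prod_flatten, List.map_ofFn, List.map_ofFn, iterDer]
  congr 2
  funext k
  simp

theorem iterDer_eq_foldr (ξ : Fin m → ℕ) (a : R) :
    iterDer ξ a = (derWord ξ).foldr (fun k b => DiffRing.der k b) a := by
  rw [iterDer_eq_prod_derWord]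
  induction derWord ξ with
  | nil => rfl
  | cons k l ih =>
    rw [List.map_cons, List.prod_cons, Module.End.mul_apply, ih]
    rfl

theorem iterDer_zero (a : R) : iterDer (0 : Fin m → ℕ) a = a := by
  simp [iterDer]

theorem commute_der (i j : Fin m) :
    Commute ((DiffRing.der i : Derivation ℤ R R).toLinearMap : Module.End ℤ R)
      (DiffRing.der j : Derivation ℤ R R).toLinearMap :=
  LinearMap.ext fun a => DiffRing.der_comm i j a

theorem prod_ofFn_mul_of_commute {M : Type*} [Monoid M] :
    ∀ {m : ℕ} (f g : Fin m → M), (∀ i j, Commute (f i) (g j)) →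
      (List.ofFn fun i => f i * g i).prod = (List.ofFn f).prod * (List.ofFn g).prod
  | 0, f, g, _ => by simp
  | m + 1, f, g, h => by
    rw [List.ofFn_succ, List.ofFn_succ, List.ofFn_succ, List.prod_cons, List.prod_cons,
      List.prod_cons, prod_ofFn_mul_of_commute _ _ fun i j => h i.succ j.succ]
    have : Commute (List.ofFn fun i : Fin m => f i.succ).prod (g 0) := by
      refine Commute.list_prod_left _ _ fun x hx => ?_
      obtain ⟨i, rfl⟩ := (List.mem_ofFn' _ _).1 hx
      exact h _ _
    rw [mul_assoc, ← mul_assoc (g 0), ← this.eq]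
    simp only [mul_assoc]

theorem iterDer_single (k : Fin m) (a : R) :
    iterDer (Pi.single k 1 : Fin m → ℕ) a = DiffRing.der k a := by
  have h : derWord (Pi.single k 1 : Fin m → ℕ) = [k] := by
    have h2 := sum_derWord (Pi.single k 1 : Fin m → ℕ)
    have hlen : (derWord (Pi.single k 1 : Fin m → ℕ)).length = 1 := by
      rw [derWord, List.length_flatten, List.map_ofFn, List.sum_ofFn]
      simp [Pi.single_apply]
    obtain ⟨j, hj⟩ := List.length_eq_one_iff.1 hlen
    rw [hj] at h2 ⊢
    have := congrFun h2 k
    by_cases hjk : k = j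
    · rw [hjk]
    · simp [hjk] at this
  rw [iterDer_eq_foldr, h]
  rfl

theorem iterDer_add_single (ξ : Fin m → ℕ) (k : Fin m) (a : R) :
    iterDer (ξ + Pi.single k 1) a = DiffRing.der k (iterDer ξ a) := by
  rw [← iterDer_single k (iterDer ξ a), add_comm, ← Module.End.mul_apply]
  congr 1
  rw [iterDer, iterDer, iterDer, ← prod_ofFn_mul_of_commute]
  · simp only [Pi.add_apply, pow_add]
  · exact fun i j => ((commute_der i j).pow_left _).pow_right _

theorem iterDer_mem {I : Ideal R} (hI : IsDiffIdeal m I) {f : R} (hf : f ∈ I) (ξ : Fin m → ℕ) :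
    iterDer ξ f ∈ I := by
  rw [iterDer_eq_foldr]
  induction derWord ξ with
  | nil => exact hf
  | cons k l ih => exact hI k _ ih

end IterDer

/-! ### Derivatives of differential polynomials -/

section Derivatives

variable {m n : ℕ} {K : Type*} [CommRing K] [DiffRing m K]

theorem der_C (k : Fin m) (a : K) :
    DiffRing.der k (C a : DiffPoly m n K) = C (DiffRing.der k a) := polyDer_C k a

theorem der_X (k : Fin m) (v : DVar m n) :
    DiffRing.der k (X v : DiffPoly m n K) = X (v.shift k) := polyDer_X k v

theorem der_mul (k : Fin m) (p q : DiffPoly m n K) :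
    DiffRing.der k (p * q) = p * DiffRing.der k q + q * DiffRing.der k p :=
  Derivation.leibniz _ _ _

/-- A map satisfying the Leibniz rule which maps the coefficients and the indeterminates in `s`
into a subalgebra containing `X w` for `w ∈ s` maps all polynomials in the indeterminates in `s`
there. -/
theorem leibniz_mem_of_mem_supported {σ : Type*} {s : Set σ}
    (D : MvPolynomial σ K → MvPolynomial σ K) (hadd : ∀ p q, D (p + q) = D p + D q)
    (hmul : ∀ p q, D (p * q) = p * D q + q * D p) (T : Subalgebra K (MvPolynomial σ K))
    (hC : ∀ a, D (C a) ∈ T) (hX : ∀ w ∈ s, D (X w) ∈ T) (hs : supported K s ≤ T)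
    {f : MvPolynomial σ K} (hf : f ∈ supported K s) : D f ∈ T := by
  rw [supported] at hf
  induction hf using Algebra.adjoin_induction with
  | mem x hx => obtain ⟨w, hw, rfl⟩ := hx; exact hX w hw
  | algebraMap a => exact hC a
  | add p q _ _ hp hq => rw [hadd]; exact T.add_mem hp hq
  | mul p q hp' hq' hp hq =>
    rw [hmul]
    exact T.add_mem (T.mul_mem (hs hp') hq) (T.mul_mem (hs hq') hp)

theorem C_mem_supported {σ : Type*} (s : Set σ) (a : K) :
    (C a : MvPolynomial σ K) ∈ supported K s := (supported K s).algebraMap_mem a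

theorem X_mem_supported_of_mem {σ : Type*} {s : Set σ} {w : σ} (h : w ∈ s) :
    (X w : MvPolynomial σ K) ∈ supported K s := Algebra.subset_adjoin ⟨w, h, rfl⟩

theorem der_mem_supported_Iio {v : DVar m n} (k : Fin m) {f : DiffPoly m n K}
    (hf : f ∈ supported K (Set.Iio v)) :
    DiffRing.der k f ∈ supported K (Set.Iio (v.shift k)) := by
  refine leibniz_mem_of_mem_supported (fun p => DiffRing.der k p) (map_add _) (der_mul k) _
    (fun a => ?_) (fun w hw => ?_) (supported_mono fun w hw => ?_) hf
  · exact (der_C (n := n) k a).symm ▸ C_mem_supported _ _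
  · exact (der_X (K := K) k w).symm ▸ X_mem_supported_of_mem (DVar.shift_strictMono k hw)
  · exact lt_trans hw (v.lt_shift k)

/-- The map `p ↦ δ_k p - (∂p/∂v) · δ_k v` satisfies the Leibniz rule, kills `v`, and sends each `w <
v` to `δ_k w < δ_k v`. -/
theorem der_sub_mem_supported_Iio {v : DVar m n} (k : Fin m) {f : DiffPoly m n K}
    (hf : f ∈ supported K (Set.Iic v)) :
    DiffRing.der k f - pderiv v f * X (v.shift k) ∈ supported K (Set.Iio (v.shift k)) := by
  refine leibniz_mem_of_mem_supported
    (fun p : DiffPoly m n K => DiffRing.der k p - pderiv v p * X (v.shift k))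
    (fun p q => ?_) (fun p q => ?_) _ (fun a => ?_) (fun w hw => ?_)
    (supported_mono fun w hw => lt_of_le_of_lt hw (v.lt_shift k)) hf
  · simp only [map_add]; ring
  · simp only [der_mul, pderiv_mul]; ring
  · simpa only [der_C, pderiv_C, zero_mul, sub_zero] using C_mem_supported _ _
  · rcases (show w ≤ v from hw).lt_or_eq with h | rfl
    · simp only [der_X, pderiv_X_of_ne h.ne, zero_mul, sub_zero]
      exact
        X_mem_supported_of_mem (K := K) (s := Set.Iio (v.shift k)) (DVar.shift_strictMono k h)
    · simp only [der_X, pderiv_X_self, one_mul, sub_self]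
      exact Subalgebra.zero_mem _

theorem pderiv_mem_supported {σ : Type*} {s : Set σ} (v : σ) {f : MvPolynomial σ K}
    (hf : f ∈ supported K s) : pderiv v f ∈ supported K s := by
  classical
  exact leibniz_mem_of_mem_supported (fun p => pderiv v p) (map_add _)
    (fun p q => by simp only [pderiv_mul]; ring) _ (fun a => by simp)
    (fun w _ => by
      rw [pderiv_X, Pi.single_apply]
      split_ifs
      · exact Subalgebra.one_mem _
      · exact Subalgebra.zero_mem _) le_rfl hf

/-- A proper derivative of `f` is linear in its leader, with the separant as coefficient. -/
theorem iterDer_sub_mem_supported_Iio {v : DVar m n} {f : DiffPoly m n K}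
    (hf : f ∈ supported K (Set.Iic v)) {ξ : Fin m → ℕ} (hξ : ξ ≠ 0) :
    iterDer ξ f - pderiv v f * X (v.add ξ) ∈ supported K (Set.Iio (v.add ξ)) := by
  have hS := pderiv_mem_supported v hf
  -- The induction is on words in the derivations, each step adding one `δ_k`. The first derivation
  -- creates the linear form, and later ones preserve it.
  suffices h : ∀ l : List (Fin m), (l.map fun k => (Pi.single k 1 : Fin m → ℕ)).sum ≠ 0 →
      l.foldr (fun k g => DiffRing.der k g) f -
          pderiv v f * X (v.add (l.map fun k => (Pi.single k 1 : Fin m → ℕ)).sum) ∈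
        supported K (Set.Iio (v.add (l.map fun k => (Pi.single k 1 : Fin m → ℕ)).sum)) by
    have := h (derWord ξ)
    rw [sum_derWord, ← iterDer_eq_foldr] at this
    exact this hξ
  clear hξ ξ
  intro l hξ
  induction l with
  | nil => simp at hξ
  | cons k l ih =>
    rw [List.foldr_cons, List.map_cons, List.sum_cons, add_comm, ← DVar.add_shift]
    by_cases hl : (l.map fun k => (Pi.single k 1 : Fin m → ℕ)).sum = 0
    · have hl' : l = [] := by
        cases l with
        | nil => rfl
        | cons j l =>
          exfalso
          have := congrFun hl j
          simp at this
      subst hl'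
      simpa [DVar.add] using der_sub_mem_supported_Iio k hf
    · have h1 := der_mem_supported_Iio k (ih hl)
      generalize (l.map fun k => (Pi.single k 1 : Fin m → ℕ)).sum = η at *
      have hv : v < v.add η := by
        have := (DVar.isProperDerivative_iff (v := v)).2 ⟨η, hl, rfl⟩
        exact this.lt
      have h2 := der_mem_supported_Iio k (v := v.add η) (f := pderiv v f)
        (supported_mono (fun w hw => lt_of_le_of_lt hw hv) hS)
      have h3 : (X (v.add η) : DiffPoly m n K) ∈ supported K (Set.Iio ((v.add η).shift k)) :=
        X_mem_supported_of_mem (DVar.lt_shift _ k)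
      have h4 := Subalgebra.add_mem _ h1 (Subalgebra.mul_mem _ h3 h2)
      rw [map_sub, der_mul, der_X] at h4
      convert h4 using 1
      -- `δ_k (S · δ^η v) = S · δ_k δ^η v + δ^η v · δ_k S`, and the last term involves only
      -- indeterminates below `δ_k δ^η v`.
      ring

end Derivatives

/-! ### Leading coefficients and pseudodivision -/

section LeadCoeff

variable {m n : ℕ} {K : Type*} [CommRing K]

theorem exists_of_mem_support_leadCoeffAt {v : DVar m n} {f : DiffPoly m n K} {t : DVar m n →₀ ℕ}
    (ht : t ∈ (leadCoeffAt v f).support) : ∃ s ∈ f.support, t = s.erase v := by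
  obtain ⟨s, hs, hts⟩ := Finset.mem_biUnion.1 (support_sum ht)
  refine ⟨s, (Finset.mem_filter.1 hs).1, ?_⟩
  simpa using support_monomial_subset hts

theorem degreeOf_leadCoeffAt_le (u v : DVar m n) (f : DiffPoly m n K) :
    degreeOf u (leadCoeffAt v f) ≤ degreeOf u f := by
  rw [degreeOf_le_iff]
  intro t ht
  obtain ⟨s, hs, rfl⟩ := exists_of_mem_support_leadCoeffAt ht
  refine le_trans ?_ (monomial_le_degreeOf u hs)
  rw [Finsupp.erase_apply]
  split_ifs
  · exact Nat.zero_le _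
  · exact le_rfl

theorem degreeOf_leadCoeffAt_self (v : DVar m n) (f : DiffPoly m n K) :
    degreeOf v (leadCoeffAt v f) = 0 := by
  rw [← Nat.le_zero, degreeOf_le_iff]
  intro t ht
  obtain ⟨s, -, rfl⟩ := exists_of_mem_support_leadCoeffAt ht
  simp

theorem leadCoeffAt_mem_supported {v : DVar m n} {f : DiffPoly m n K} {s : Set (DVar m n)}
    (hf : f ∈ supported K s) : leadCoeffAt v f ∈ supported K s := by
  rw [mem_supported] at hf ⊢
  intro w hw
  obtain ⟨t, ht, hwt⟩ := (mem_vars_iff_mem_support _).1 (Finset.mem_coe.1 hw)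
  obtain ⟨t', ht', rfl⟩ := exists_of_mem_support_leadCoeffAt ht
  rw [Finsupp.support_erase] at hwt
  exact hf ((mem_vars_iff_mem_support _).2 ⟨t', ht', Finset.mem_of_mem_erase hwt⟩)

theorem leadCoeffAt_mul_X_pow (v : DVar m n) (f : DiffPoly m n K) :
    leadCoeffAt v f * X v ^ degreeOf v f =
      ∑ s ∈ f.support with s v = degreeOf v f, monomial s (coeff s f) := by
  rw [leadCoeffAt, Finset.sum_mul]
  refine Finset.sum_congr rfl fun s hs => ?_
  rw [X_pow_eq_monomial, monomial_mul, mul_one, ← (Finset.mem_filter.1 hs).2,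
    Finsupp.erase_add_single]

theorem degreeOf_sub_leadCoeffAt_lt {v : DVar m n} {f : DiffPoly m n K} (hf : 0 < degreeOf v f) :
    degreeOf v (f - leadCoeffAt v f * X v ^ degreeOf v f) < degreeOf v f := by
  have h : f - leadCoeffAt v f * X v ^ degreeOf v f =
      ∑ s ∈ f.support with ¬ s v = degreeOf v f, monomial s (coeff s f) := by
    rw [leadCoeffAt_mul_X_pow, sub_eq_iff_eq_add', Finset.sum_filter_add_sum_filter_not]
    exact f.as_sum
  rw [h, degreeOf_lt_iff hf]
  intro t ht
  obtain ⟨s, hs, hts⟩ := Finset.mem_biUnion.1 (support_sum ht)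
  obtain rfl : t = s := by simpa using support_monomial_subset hts
  obtain ⟨h1, h2⟩ := Finset.mem_filter.1 hs
  exact lt_of_le_of_ne (monomial_le_degreeOf v h1) h2

theorem leadCoeffAt_ne_zero {v : DVar m n} {f : DiffPoly m n K} (hf : 0 < degreeOf v f) :
    leadCoeffAt v f ≠ 0 := by
  intro h
  have := degreeOf_sub_leadCoeffAt_lt hf
  rw [h, zero_mul, sub_zero] at this
  exact this.false

theorem degreeOf_pos_iff_mem_vars {σ : Type*} {v : σ} {f : MvPolynomial σ K} :
    0 < degreeOf v f ↔ v ∈ f.vars := by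
  classical
  rw [vars_def, Multiset.mem_toFinset, degreeOf_def, Multiset.count_pos]

/-- A single step of pseudodivision. -/
theorem degreeOf_pseudodivision_step {v : DVar m n} {f g : DiffPoly m n K} (hf : 0 < degreeOf v f)
    (hfg : degreeOf v f ≤ degreeOf v g) :
    degreeOf v (leadCoeffAt v f * g -
      leadCoeffAt v g * X v ^ (degreeOf v g - degreeOf v f) * f) < degreeOf v g := by
  -- The top terms of the two products agree, so both polynomials may be replaced by their tails of
  -- lower degree in `v`.
  have h : leadCoeffAt v f * g - leadCoeffAt v g * X v ^ (degreeOf v g - degreeOf v f) * f =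
      leadCoeffAt v f * (g - leadCoeffAt v g * X v ^ degreeOf v g) -
        leadCoeffAt v g * X v ^ (degreeOf v g - degreeOf v f) *
          (f - leadCoeffAt v f * X v ^ degreeOf v f) := by
    have : (X v : DiffPoly m n K) ^ degreeOf v g =
        X v ^ (degreeOf v g - degreeOf v f) * X v ^ degreeOf v f := by
      rw [← pow_add, Nat.sub_add_cancel hfg]
    rw [this]; ring
  rw [h]
  have h1 := degreeOf_sub_leadCoeffAt_lt hf
  have h2 := degreeOf_sub_leadCoeffAt_lt (hf.trans_le hfg)
  have h3 := degreeOf_leadCoeffAt_self v f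
  have h4 := degreeOf_leadCoeffAt_self v g
  have h5 := degreeOf_mul_le v (leadCoeffAt v f) (g - leadCoeffAt v g * X v ^ degreeOf v g)
  have h6 := degreeOf_mul_le v (leadCoeffAt v g * X v ^ (degreeOf v g - degreeOf v f))
    (f - leadCoeffAt v f * X v ^ degreeOf v f)
  have h7 := degreeOf_mul_le v (leadCoeffAt v g)
    ((X v : DiffPoly m n K) ^ (degreeOf v g - degreeOf v f))
  have h8 : degreeOf v ((X v : DiffPoly m n K) ^ (degreeOf v g - degreeOf v f)) ≤
      degreeOf v g - degreeOf v f := by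
    rcases subsingleton_or_nontrivial K with h | h
    · rw [Subsingleton.elim (X v ^ _ : DiffPoly m n K) 0]; simp
    · rw [degreeOf_X_self_pow]
  refine (degreeOf_sub_le v _ _).trans_lt ?_
  rw [max_lt_iff]
  omega

/-- The second clause is what permits successive divisions by several polynomials: bounds in
indeterminates absent from the divisor survive. -/
theorem exists_pseudodivision {v : DVar m n} {f : DiffPoly m n K} (hf : 0 < degreeOf v f)
    (g : DiffPoly m n K) :
    ∃ (k : ℕ) (q : DiffPoly m n K),
      degreeOf v (leadCoeffAt v f ^ k * g - q * f) < degreeOf v f ∧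
      (∀ u, degreeOf u f = 0 → degreeOf u (leadCoeffAt v f ^ k * g - q * f) ≤ degreeOf u g) ∧
      ∀ s, f ∈ supported K s → g ∈ supported K s →
        leadCoeffAt v f ^ k * g - q * f ∈ supported K s := by
  induction hd : degreeOf v g using Nat.strong_induction_on generalizing g with
  | _ d ih =>
    by_cases hlt : degreeOf v g < degreeOf v f
    · exact ⟨0, 0, by simpa using hlt, by simp, by simp⟩
    rw [not_lt] at hlt
    set q₀ := leadCoeffAt v g * X v ^ (degreeOf v g - degreeOf v f) with hq₀
    obtain ⟨k, q, h1, h2, h3⟩ := ih _ (hd ▸ degreeOf_pseudodivision_step hf hlt)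
      (leadCoeffAt v f * g - q₀ * f) rfl
    have heq : leadCoeffAt v f ^ (k + 1) * g - (leadCoeffAt v f ^ k * q₀ + q) * f =
        leadCoeffAt v f ^ k * (leadCoeffAt v f * g - q₀ * f) - q * f := by ring
    refine ⟨k + 1, leadCoeffAt v f ^ k * q₀ + q, ?_, ?_, ?_⟩
    · rwa [heq]
    · intro u hu
      rw [heq]
      have huv : u ≠ v := by rintro rfl; omega
      refine (h2 u hu).trans ((degreeOf_sub_le u _ _).trans (max_le ?_ ?_))
      · have := degreeOf_mul_le u (leadCoeffAt v f) g
        have := degreeOf_leadCoeffAt_le u v f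
        omega
      · have := degreeOf_mul_le u q₀ f
        rw [hq₀, degreeOf_mul_X_pow_of_ne _ huv, ← hq₀] at this
        have := degreeOf_leadCoeffAt_le u v g
        omega
    · intro s hfs hgs
      rw [heq]
      have hX : (X v : DiffPoly m n K) ∈ supported K s :=
        X_mem_supported_of_mem (mem_supported.1 hfs (degreeOf_pos_iff_mem_vars.1 hf))
      exact h3 s hfs (Subalgebra.sub_mem _
        (Subalgebra.mul_mem _ (leadCoeffAt_mem_supported hfs) hgs)
        (Subalgebra.mul_mem _ (Subalgebra.mul_mem _ (leadCoeffAt_mem_supported hgs)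
          (Subalgebra.pow_mem _ hX _)) hfs))

end LeadCoeff

/-! ### Leaders and reducedness -/

section Leader

variable {m n : ℕ} {K : Type*} [CommRing K]

theorem leader_eq_coe_iff {f : DiffPoly m n K} {v : DVar m n} :
    leader f = v ↔ v ∈ f.vars ∧ f ∈ supported K (Set.Iic v) := by
  rw [mem_supported]
  constructor
  · intro h
    exact ⟨Finset.mem_of_max h, fun w hw => Finset.le_max_of_eq hw h⟩
  · rintro ⟨h1, h2⟩
    exact le_antisymm (Finset.max_le fun w hw => WithBot.coe_le_coe.2 (h2 hw)) (Finset.le_max h1)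

theorem exists_leader {f : DiffPoly m n K} (hf : f.vars.Nonempty) :
    ∃ v : DVar m n, leader f = v := Finset.max_of_nonempty hf

theorem nonempty_of_leader {f : DiffPoly m n K} {v : DVar m n} (h : leader f = v) :
    f.vars.Nonempty := ⟨v, (leader_eq_coe_iff.1 h).1⟩

theorem max'_vars_of_leader {f : DiffPoly m n K} {v : DVar m n} (h : leader f = v) :
    f.vars.max' (nonempty_of_leader h) = v :=
  WithBot.coe_injective ((Finset.coe_max' _).trans h)

theorem initial_of_leader {f : DiffPoly m n K} {v : DVar m n} (h : leader f = v) :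
    initial f = leadCoeffAt v f := by
  rw [initial, dif_pos (nonempty_of_leader h), max'_vars_of_leader h]

theorem separant_of_leader {f : DiffPoly m n K} {v : DVar m n} (h : leader f = v) :
    separant f = pderiv v f := by
  rw [separant, dif_pos (nonempty_of_leader h), max'_vars_of_leader h]

theorem leadDeg_of_leader {f : DiffPoly m n K} {v : DVar m n} (h : leader f = v) :
    leadDeg f = degreeOf v f := by
  rw [leadDeg, dif_pos (nonempty_of_leader h), max'_vars_of_leader h]

theorem degreeOf_leader_pos {f : DiffPoly m n K} {v : DVar m n} (h : leader f = v) :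
    0 < degreeOf v f := degreeOf_pos_iff_mem_vars.2 (leader_eq_coe_iff.1 h).1

theorem isReduced_iff {f g : DiffPoly m n K} {v : DVar m n} (h : leader f = v) :
    IsReduced g f ↔ (∀ w ∈ g.vars, ¬ w.IsProperDerivative v) ∧ degreeOf v g < degreeOf v f := by
  constructor
  · rintro ⟨u, hu, hg⟩
    obtain rfl : v = u := WithBot.coe_injective (h.symm.trans hu)
    exact hg
  · exact fun hg => ⟨v, h, hg⟩

theorem degreeOf_eq_zero_of_lt_leader {f : DiffPoly m n K} {u v : DVar m n} (h : leader f = v)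
    (hv : v < u) : degreeOf u f = 0 := by
  rw [← Nat.le_zero, ← not_lt, degreeOf_pos_iff_mem_vars]
  exact fun hu => hv.not_ge (mem_supported.1 (leader_eq_coe_iff.1 h).2 hu)

theorem exists_of_mem_support_pderiv {σ : Type*} {v : σ} {f : MvPolynomial σ K} {t : σ →₀ ℕ}
    (ht : t ∈ (pderiv v f).support) : t + Finsupp.single v 1 ∈ f.support := by
  rw [mem_support_iff, coeff_pderiv] at ht
  exact mem_support_iff.2 (left_ne_zero_of_mul ht)

theorem degreeOf_pderiv_le {σ : Type*} (u v : σ) (f : MvPolynomial σ K) :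
    degreeOf u (pderiv v f) ≤ degreeOf u f := by
  rw [degreeOf_le_iff]
  intro t ht
  refine le_trans ?_ (monomial_le_degreeOf u (exists_of_mem_support_pderiv ht))
  simp

theorem degreeOf_pderiv_self_lt {σ : Type*} {v : σ} {f : MvPolynomial σ K}
    (hf : 0 < degreeOf v f) : degreeOf v (pderiv v f) < degreeOf v f := by
  rw [degreeOf_lt_iff hf]
  intro t ht
  have := monomial_le_degreeOf v (exists_of_mem_support_pderiv ht)
  simpa using this

theorem pderiv_ne_zero {σ : Type*} [IsDomain K] [CharZero K] {v : σ} {f : MvPolynomial σ K}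
    (hf : 0 < degreeOf v f) : pderiv v f ≠ 0 := by
  obtain ⟨s, hs, hsv⟩ := (mem_vars_iff_mem_support v).1 (degreeOf_pos_iff_mem_vars.1 hf)
  have hle : Finsupp.single v 1 ≤ s := by
    rw [Finsupp.single_le_iff]
    have := Finsupp.mem_support_iff.1 hsv
    omega
  intro h
  have hc := coeff_pderiv (i := v) f (s - Finsupp.single v 1)
  rw [h, coeff_zero, tsub_add_cancel_of_le hle] at hc
  exact mul_ne_zero (mem_support_iff.1 hs) (Nat.cast_add_one_ne_zero _) hc.symm

end Leader

/-! ### Reduction modulo an autoreduced set -/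

section Reduction

variable {m n : ℕ} {K : Type*} [CommRing K]

/-- The indeterminates which are not proper derivatives of leaders of elements of `Λ`. -/
def partialVars (Λ : Finset (DiffPoly m n K)) : Set (DVar m n) :=
  {w | ∀ f ∈ Λ, ∀ v : DVar m n, leader f = v → ¬ w.IsProperDerivative v}

/-- The multiplicative monoid generated by the initials and separants of the elements of `Λ`. -/
def initSepMonoid (Λ : Finset (DiffPoly m n K)) : Submonoid (DiffPoly m n K) :=
  Submonoid.closure {p | ∃ f ∈ Λ, p = initial f ∨ p = separant f}

theorem initial_mem_initSepMonoid {Λ : Finset (DiffPoly m n K)} {f : DiffPoly m n K}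
    (hf : f ∈ Λ) : initial f ∈ initSepMonoid Λ := Submonoid.subset_closure ⟨f, hf, Or.inl rfl⟩

theorem separant_mem_initSepMonoid {Λ : Finset (DiffPoly m n K)} {f : DiffPoly m n K}
    (hf : f ∈ Λ) : separant f ∈ initSepMonoid Λ := Submonoid.subset_closure ⟨f, hf, Or.inr rfl⟩

/-- Turns the multipliers produced by reduction into powers of `H_Λ`. The cofactor stays in the
monoid, so multiplying by it keeps a polynomial partially reduced. -/
theorem exists_mul_eq_HProd_pow {Λ : Finset (DiffPoly m n K)} {h : DiffPoly m n K}
    (hh : h ∈ initSepMonoid Λ) : ∃ h' ∈ initSepMonoid Λ, ∃ l : ℕ, h * h' = HProd Λ ^ l := by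
  classical
  induction hh using Submonoid.closure_induction with
  | mem x hx =>
    obtain ⟨f, hf, hx⟩ := hx
    have hprod : ∏ g ∈ Λ.erase f, initial g * separant g ∈ initSepMonoid Λ :=
      Submonoid.prod_mem _ fun g hg => Submonoid.mul_mem _
        (initial_mem_initSepMonoid (Finset.mem_of_mem_erase hg))
        (separant_mem_initSepMonoid (Finset.mem_of_mem_erase hg))
    have hH : HProd Λ = initial f * separant f * ∏ g ∈ Λ.erase f, initial g * separant g :=
      (Finset.mul_prod_erase _ (fun g => initial g * separant g) hf).symm
    rcases hx with rfl | rfl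
    · exact ⟨_, Submonoid.mul_mem _ (separant_mem_initSepMonoid hf) hprod, 1, by rw [hH]; ring⟩
    · exact ⟨_, Submonoid.mul_mem _ (initial_mem_initSepMonoid hf) hprod, 1, by rw [hH]; ring⟩
  | one => exact ⟨1, Submonoid.one_mem _, 0, by simp⟩
  | mul x y _ _ hx hy =>
    obtain ⟨x', hx', k, hk⟩ := hx
    obtain ⟨y', hy', l, hl⟩ := hy
    exact ⟨x' * y', Submonoid.mul_mem _ hx' hy', k + l, by rw [pow_add, ← hk, ← hl]; ring⟩

theorem IsAutoreduced.mem_supported_partialVars {Λ : Finset (DiffPoly m n K)}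
    (hΛ : IsAutoreduced Λ) {f : DiffPoly m n K} (hf : f ∈ Λ) :
    f ∈ supported K (partialVars Λ) := by
  rw [mem_supported]
  intro w hw f' hf' v hv
  by_cases h : f = f'
  · subst h
    exact fun hwv => hwv.lt.not_ge (mem_supported.1 (leader_eq_coe_iff.1 hv).2 hw)
  · exact ((isReduced_iff hv).1 (hΛ.2 f' hf' f hf h)).1 w hw

theorem IsAutoreduced.leader_injOn {Λ : Finset (DiffPoly m n K)} (hΛ : IsAutoreduced Λ)
    {f g : DiffPoly m n K} (hf : f ∈ Λ) (hg : g ∈ Λ) (h : leader f = leader g) : f = g := by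
  by_contra hne
  obtain ⟨v, hv⟩ := exists_leader (hΛ.1 f hf)
  have h1 := ((isReduced_iff hv).1 (hΛ.2 f hf g hg (Ne.symm hne))).2
  have h2 := ((isReduced_iff (h.symm.trans hv)).1 (hΛ.2 g hg f hf hne)).2
  omega

theorem IsAutoreduced.initSepMonoid_le {Λ : Finset (DiffPoly m n K)} (hΛ : IsAutoreduced Λ) :
    initSepMonoid Λ ≤ (supported K (partialVars Λ)).toSubmonoid := by
  rw [initSepMonoid, Submonoid.closure_le]
  rintro p ⟨f, hf, hp⟩
  obtain ⟨v, hv⟩ := exists_leader (hΛ.1 f hf)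
  rcases hp with rfl | rfl
  · rw [initial_of_leader hv]
    exact leadCoeffAt_mem_supported (hΛ.mem_supported_partialVars hf)
  · rw [separant_of_leader hv]
    exact pderiv_mem_supported v (hΛ.mem_supported_partialVars hf)

/-- A polynomial reduces, modulo an autoreduced set and up to a product of initials, to one with low degrees in the leaders. -/
theorem IsAutoreduced.exists_algebraic_reduction {Λ : Finset (DiffPoly m n K)}
    (hΛ : IsAutoreduced Λ) {s : Set (DVar m n)} (hs : ∀ f ∈ Λ, f ∈ supported K s)
    {g : DiffPoly m n K} (hg : g ∈ supported K s) :
    ∃ h ∈ initSepMonoid Λ, ∃ g' ∈ supported K s,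
      h * g - g' ∈ Ideal.span (Λ : Set (DiffPoly m n K)) ∧
      ∀ f ∈ Λ, ∀ v : DVar m n, leader f = v → degreeOf v g' < degreeOf v f := by
  classical
  suffices H : ∀ Γ : Finset (DiffPoly m n K), Γ ⊆ Λ →
      ∃ h ∈ initSepMonoid Λ, ∃ g' ∈ supported K s,
        h * g - g' ∈ Ideal.span (Λ : Set (DiffPoly m n K)) ∧
        ∀ f ∈ Γ, ∀ v : DVar m n, leader f = v → degreeOf v g' < degreeOf v f from H Λ le_rfl
  intro Γ
  -- Elements enter in order of decreasing leader: a divisor with a lower leader does not contain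
  -- the leaders treated before, so the degrees already achieved there are not raised.
  refine Finset.induction_on_min_value leader Γ
    (fun _ => ⟨1, Submonoid.one_mem _, g, hg, by simp, by simp⟩) ?_
  · intro f Γ hfΓ hmin ih hsub
    have hfΛ : f ∈ Λ := hsub (Finset.mem_insert_self _ _)
    have hΓΛ : Γ ⊆ Λ := (Finset.subset_insert _ _).trans hsub
    obtain ⟨h, hh, g', hg', hI, hdeg⟩ := ih hΓΛ
    obtain ⟨v, hv⟩ := exists_leader (hΛ.1 f hfΛ)
    obtain ⟨k, q, h1, h2, h3⟩ := exists_pseudodivision (degreeOf_leader_pos hv) g'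
    refine ⟨initial f ^ k * h, Submonoid.mul_mem _
      (Submonoid.pow_mem _ (initial_mem_initSepMonoid hfΛ) _) hh, _, h3 s (hs f hfΛ) hg', ?_, ?_⟩
    · rw [initial_of_leader hv]
      have : leadCoeffAt v f ^ k * h * g - (leadCoeffAt v f ^ k * g' - q * f) =
          leadCoeffAt v f ^ k * (h * g - g') + q * f := by ring
      rw [this]
      exact Ideal.add_mem _ (Ideal.mul_mem_left _ _ hI)
        (Ideal.mul_mem_left _ _ (Ideal.subset_span hfΛ))
    · intro f' hf' v' hv'
      rcases Finset.mem_insert.1 hf' with rfl | hf'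
      · obtain rfl : v = v' := WithBot.coe_injective (hv.symm.trans hv')
        exact h1
      · refine (h2 v' (degreeOf_eq_zero_of_lt_leader hv ?_)).trans_lt (hdeg f' hf' v' hv')
        refine lt_of_le_of_ne ?_ ?_
        · have := hmin f' hf'
          rwa [hv, hv', WithBot.coe_le_coe] at this
        · rintro rfl
          have := hΛ.leader_injOn hfΛ (hΓΛ hf') (hv.trans hv'.symm)
          exact hfΓ (this ▸ hf')

variable [DiffRing m K]

/-- The ideal of the full ring generated by the derivatives of order at most `r` of elements
of `Λ`. -/
def truncSpan (Λ : Finset (DiffPoly m n K)) (r : ℕ) : Ideal (DiffPoly m n K) :=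
  Ideal.span {g | g ∈ orderLE m n K r ∧ ∃ ξ : Fin m → ℕ, ∃ f ∈ Λ, g = iterDer ξ f}

theorem subset_truncSpan {Λ : Finset (DiffPoly m n K)} {r : ℕ}
    (hr : ∀ f ∈ Λ, f ∈ orderLE m n K r) : (Λ : Set (DiffPoly m n K)) ⊆ truncSpan Λ r :=
  fun f hf => Ideal.subset_span ⟨hr f hf, 0, f, hf, (iterDer_zero _).symm⟩

theorem truncSpan_le {Λ : Finset (DiffPoly m n K)} {P : Ideal (DiffPoly m n K)}
    (hP : IsDiffIdeal m P) (hΛP : ∀ f ∈ Λ, f ∈ P) (r : ℕ) : truncSpan Λ r ≤ P := by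
  rw [truncSpan, Ideal.span_le]
  rintro _ ⟨-, ξ, f, hf, rfl⟩
  exact iterDer_mem hP (hΛP f hf) ξ

/-- Multiplying by initials and separants of `Λ`, polynomials can be brought into partially
reduced form, where polynomials of order at most `r` only need derivatives of order at most
`r` of elements of `Λ`. -/
theorem IsAutoreduced.exists_partial_reduction {Λ : Finset (DiffPoly m n K)}
    (hΛ : IsAutoreduced Λ) (r : ℕ) {g : DiffPoly m n K}
    (hg : g ∈ supported K ({v | v.order ≤ r} ∪ partialVars Λ)) :
    ∃ h ∈ initSepMonoid Λ, ∃ g' ∈ supported K (partialVars Λ), h * g - g' ∈ truncSpan Λ r := by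
  -- The reducible polynomials form a subalgebra, so it is enough to reduce single indeterminates.
  have key : ∀ s : Set (DVar m n), (∀ w ∈ s, ∃ h ∈ initSepMonoid Λ,
      ∃ g' ∈ supported K (partialVars Λ), h * X w - g' ∈ truncSpan Λ r) →
      ∀ g ∈ supported K s, ∃ h ∈ initSepMonoid Λ, ∃ g' ∈ supported K (partialVars Λ),
        h * g - g' ∈ truncSpan Λ r := by
    intro s hs g hg
    rw [supported] at hg
    induction hg using Algebra.adjoin_induction with
    | mem x hx => obtain ⟨w, hw, rfl⟩ := hx; exact hs w hw
    | algebraMap a => exact ⟨1, Submonoid.one_mem _, C a, C_mem_supported _ _, by simp⟩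
    | add p q _ _ hp hq =>
      obtain ⟨h₁, hh₁, p', hp', hI₁⟩ := hp
      obtain ⟨h₂, hh₂, q', hq', hI₂⟩ := hq
      refine ⟨h₁ * h₂, Submonoid.mul_mem _ hh₁ hh₂, h₂ * p' + h₁ * q', Subalgebra.add_mem _
        (Subalgebra.mul_mem _ (hΛ.initSepMonoid_le hh₂) hp')
        (Subalgebra.mul_mem _ (hΛ.initSepMonoid_le hh₁) hq'), ?_⟩
      convert Ideal.add_mem _ (Ideal.mul_mem_left _ h₂ hI₁) (Ideal.mul_mem_left _ h₁ hI₂) using 1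
      ring
    | mul p q _ _ hp hq =>
      obtain ⟨h₁, hh₁, p', hp', hI₁⟩ := hp
      obtain ⟨h₂, hh₂, q', hq', hI₂⟩ := hq
      refine ⟨h₁ * h₂, Submonoid.mul_mem _ hh₁ hh₂, p' * q', Subalgebra.mul_mem _ hp' hq', ?_⟩
      convert Ideal.add_mem _ (Ideal.mul_mem_left _ (h₂ * q) hI₁) (Ideal.mul_mem_left _ p' hI₂)
        using 1
      ring
  refine key _ (fun w hw => ?_) g hg
  have hpar : ∀ w ∈ partialVars Λ, ∃ h ∈ initSepMonoid Λ,
      ∃ g' ∈ supported K (partialVars Λ), h * X w - g' ∈ truncSpan Λ r := fun w hw =>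
    ⟨1, Submonoid.one_mem _, X w, X_mem_supported_of_mem hw, by simp⟩
  rcases hw with hw | hw
  -- Let `w = δ^ξ v_f` and `T = δ^ξ f - S_f w`, which lies below `w`. By induction `h T ≡ T'`, hence
  -- `h S_f w ≡ -T'`.
  · induction w using WellFoundedLT.induction with
    | _ w ih =>
      by_cases hwp : w ∈ partialVars Λ
      · exact hpar w hwp
      obtain ⟨f, hf, v, hv, hwv⟩ : ∃ f ∈ Λ, ∃ v : DVar m n, leader f = v ∧
          w.IsProperDerivative v := by
        simpa [partialVars] using hwp
      obtain ⟨ξ, hξ, rfl⟩ := DVar.isProperDerivative_iff.1 hwv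
      have hT := iterDer_sub_mem_supported_Iio (leader_eq_coe_iff.1 hv).2 hξ
      rw [← separant_of_leader hv] at hT
      obtain ⟨h, hh, T', hT', hI⟩ := key (Set.Iio (v.add ξ))
        (fun u hu => ih u hu ((DVar.order_le_of_le (le_of_lt hu)).trans hw)) _ hT
      refine ⟨h * separant f, Submonoid.mul_mem _ hh (separant_mem_initSepMonoid hf), -T',
        Subalgebra.neg_mem _ hT', ?_⟩
      have hmem : iterDer ξ f ∈ truncSpan Λ r := by
        refine Ideal.subset_span ⟨?_, ξ, f, hf, rfl⟩
        -- This is where orderliness of the ranking enters: indeterminates below `w` have order at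
        -- most that of `w`, so `δ^ξ f` has order at most `r`.
        have h1 : supported K (Set.Iio (v.add ξ)) ≤ orderLE m n K r :=
          supported_mono fun u hu => (DVar.order_le_of_le (le_of_lt hu)).trans hw
        have h2 : supported K (Set.Iic v) ≤ orderLE m n K r :=
          supported_mono fun u hu => (DVar.order_le_of_le (le_trans hu hwv.lt.le)).trans hw
        have h3 := Subalgebra.add_mem _ (h1 hT) (Subalgebra.mul_mem _
          (h2 (separant_of_leader hv ▸ pderiv_mem_supported v (leader_eq_coe_iff.1 hv).2))
          (X_mem_supported_of_mem (s := {v : DVar m n | v.order ≤ r}) hw))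
        rwa [sub_add_cancel] at h3
      convert Ideal.sub_mem _ (Ideal.mul_mem_left _ h hmem) hI using 1
      ring
  · exact hpar w hw

/-- Partial reduction comes before algebraic reduction, because the latter takes place inside
`partialVars Λ` and introduces no proper derivative of a leader. -/
theorem IsAutoreduced.exists_reduction {Λ : Finset (DiffPoly m n K)} (hΛ : IsAutoreduced Λ)
    {r : ℕ} (hr : ∀ f ∈ Λ, f ∈ orderLE m n K r) {g : DiffPoly m n K}
    (hg : g ∈ supported K ({v | v.order ≤ r} ∪ partialVars Λ)) :
    ∃ h ∈ initSepMonoid Λ, ∃ g', h * g - g' ∈ truncSpan Λ r ∧ ∀ f ∈ Λ, IsReduced g' f := by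
  obtain ⟨h₁, hh₁, g₁, hg₁, hI₁⟩ := hΛ.exists_partial_reduction r hg
  obtain ⟨h₂, hh₂, g₂, hg₂, hI₂, hdeg⟩ :=
    hΛ.exists_algebraic_reduction (fun f hf => hΛ.mem_supported_partialVars hf) hg₁
  refine ⟨h₂ * h₁, Submonoid.mul_mem _ hh₂ hh₁, g₂, ?_, fun f hf => ?_⟩
  · convert Ideal.add_mem _ (Ideal.mul_mem_left _ h₂ hI₁)
      (Ideal.span_le.2 (subset_truncSpan hr) hI₂) using 1
    ring
  · obtain ⟨v, hv⟩ := exists_leader (hΛ.1 f hf)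
    exact (isReduced_iff hv).2 ⟨fun w hw => mem_supported.1 hg₂ hw f hf v hv, hdeg f hf v hv⟩

end Reduction

/-! ### Characteristic sets -/

section CharSet

variable {m n : ℕ} {K : Type*} [Field K]

/-- An autoreduced subset `Λ` of `P` such that no nonzero element of `P` is reduced with respect
to all elements of `Λ`. -/
structure IsReducing (Λ : Finset (DiffPoly m n K)) (P : Ideal (DiffPoly m n K)) : Prop where
  isAutoreduced : IsAutoreduced Λ
  mem : ∀ f ∈ Λ, f ∈ P
  eq_zero : ∀ g ∈ P, (∀ f ∈ Λ, IsReduced g f) → g = 0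

theorem vars_nonempty_of_mem {P : Ideal (DiffPoly m n K)} (hP : P ≠ ⊤) {g : DiffPoly m n K}
    (hg : g ∈ P) (h0 : g ≠ 0) : g.vars.Nonempty := by
  by_contra hne
  rw [Finset.not_nonempty_iff_eq_empty] at hne
  have hmem : g ∈ supported K (∅ : Set (DVar m n)) := by rw [mem_supported, hne]; simp
  rw [supported_empty, Algebra.mem_bot] at hmem
  obtain ⟨c, rfl⟩ := hmem
  refine hP (Ideal.eq_top_of_isUnit_mem _ hg (IsUnit.map _ (IsUnit.mk0 c ?_)))
  rintro rfl
  exact h0 (map_zero _)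

theorem sort_add_of_forall_le {α : Type*} [LinearOrder α] (s t : Multiset α)
    (h : ∀ a ∈ s, ∀ b ∈ t, a ≤ b) : (s + t).sort = s.sort ++ t.sort := by
  refine List.Perm.eq_of_pairwise' (r := (· ≤ ·)) (Multiset.pairwise_sort _ _) ?_ ?_
  · rw [List.pairwise_append]
    exact ⟨Multiset.pairwise_sort _ _, Multiset.pairwise_sort _ _, fun a ha b hb =>
      h a ((Multiset.mem_sort _).1 ha) b ((Multiset.mem_sort _).1 hb)⟩
  · rw [← Multiset.coe_eq_coe, ← Multiset.coe_add]
    simp only [Multiset.sort_eq]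

theorem rank_of_leader {f : DiffPoly m n K} {v : DVar m n} (h : leader f = v) :
    rank f = toLex ((v : WithBot (DVar m n)), degreeOf v f) := by
  rw [rank, h, leadDeg_of_leader h]

theorem IsReduced.rank_ne {f g : DiffPoly m n K} (h : IsReduced g f) : rank f ≠ rank g := by
  obtain ⟨v, hv, -, hdeg⟩ := h
  intro heq
  have hv' : leader g = v := by
    have := congrArg (fun x => (ofLex x).1) heq
    exact this.symm.trans hv
  rw [rank_of_leader hv, rank_of_leader hv'] at heq
  have := congrArg (fun x => (ofLex x).2) heq
  exact hdeg.ne this.symm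

/-- Equal leaders would contradict the degree bound, so `g` has the strictly higher leader, and
neither it nor its derivatives can occur in `f`. -/
theorem IsReduced.symm_of_rank_lt {f g : DiffPoly m n K} (h : IsReduced g f)
    (hg : g.vars.Nonempty) (hlt : rank f < rank g) : IsReduced f g := by
  obtain ⟨v, hv, -, hdeg⟩ := h
  obtain ⟨u, hu⟩ := exists_leader hg
  rw [rank_of_leader hv, rank_of_leader hu, Prod.Lex.toLex_lt_toLex, WithBot.coe_lt_coe,
    WithBot.coe_inj] at hlt
  have hvu : v < u := by
    rcases hlt with hlt | ⟨rfl, hlt⟩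
    · exact hlt
    · exact absurd hlt hdeg.not_gt
  refine (isReduced_iff hu).2 ⟨fun w hw hwu => ?_, ?_⟩
  · exact (hvu.trans hwu.lt).not_ge (mem_supported.1 (leader_eq_coe_iff.1 hv).2 hw)
  · rw [degreeOf_eq_zero_of_lt_leader hv hvu]
    exact degreeOf_leader_pos hu

/-- A nonzero reduced `g ∈ P`, joined to the elements of `Λ` of rank below that of `g`, would give a
lower autoreduced subset of `P`. -/
theorem IsCharSet.isReducing {Λ : Finset (DiffPoly m n K)} {P : Ideal (DiffPoly m n K)}
    (hP : P ≠ ⊤) (h : IsCharSet Λ P) : IsReducing Λ P := by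
  classical
  refine ⟨h.1, h.2.1, fun g hg hred => ?_⟩
  by_contra h0
  have hne := vars_nonempty_of_mem hP hg h0
  set Λ₁ := Λ.filter fun f => rank f < rank g with hΛ₁
  set Λ₂ := Λ.filter fun f => ¬ rank f < rank g with hΛ₂
  have hgΛ₁ : g ∉ Λ₁ := fun hg' => (Finset.mem_filter.1 hg').2.false
  have hsub : ∀ f ∈ Λ₁, f ∈ Λ := fun f hf => (Finset.mem_filter.1 hf).1
  refine h.2.2 (insert g Λ₁) ⟨?_, ?_⟩ ?_ ?_
  · intro f hf
    rcases Finset.mem_insert.1 hf with rfl | hf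
    · exact hne
    · exact h.1.1 f (hsub f hf)
  · intro f hf f' hf' hff'
    rcases Finset.mem_insert.1 hf with rfl | hf <;> rcases Finset.mem_insert.1 hf' with rfl | hf'
    · exact absurd rfl hff'
    · exact (hred f' (hsub f' hf')).symm_of_rank_lt hne (Finset.mem_filter.1 hf').2
    · exact hred f (hsub f hf)
    · exact h.1.2 f (hsub f hf) f' (hsub f' hf') hff'
  · intro f hf
    rcases Finset.mem_insert.1 hf with rfl | hf
    · exact hg
    · exact h.2.1 f (hsub f hf)
  · have hΓ : rankList (insert g Λ₁) = (Λ₁.val.map rank).sort ++ [rank g] := by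
      rw [rankList, Finset.insert_val_of_notMem hgΛ₁, ← Multiset.singleton_add, add_comm,
        Multiset.map_add, sort_add_of_forall_le, Multiset.map_singleton, Multiset.sort_singleton]
      intro a ha b hb
      obtain ⟨f, hf, rfl⟩ := Multiset.mem_map.1 ha
      obtain rfl : b = rank g := by simpa using hb
      exact (Finset.mem_filter.1 hf).2.le
    have hΛ : rankList Λ = (Λ₁.val.map rank).sort ++ (Λ₂.val.map rank).sort := by
      rw [← sort_add_of_forall_le, ← Multiset.map_add, rankList]
      · congr 2
        rw [hΛ₁, hΛ₂, Finset.filter_val, Finset.filter_val, Multiset.filter_add_not]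
      · intro a ha b hb
        obtain ⟨f, hf, rfl⟩ := Multiset.mem_map.1 ha
        obtain ⟨f', hf', rfl⟩ := Multiset.mem_map.1 hb
        exact (Finset.mem_filter.1 hf).2.le.trans (not_lt.1 (Finset.mem_filter.1 hf').2)
    rw [RanksLower, hΓ, hΛ]
    have hmem : ∀ b ∈ (Λ₂.val.map rank).sort, rank g < b := by
      intro b hb
      obtain ⟨f, hf, rfl⟩ := Multiset.mem_map.1 ((Multiset.mem_sort _).1 hb)
      obtain ⟨hf, hle⟩ := Finset.mem_filter.1 hf
      exact lt_of_le_of_ne (not_lt.1 hle) (hred f hf).rank_ne.symm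
    generalize (Λ₁.val.map rank).sort = l at *
    generalize (Λ₂.val.map rank).sort = l' at *
    -- If no element of `Λ` ranks above `g`, the new list extends the old one; otherwise the lists
    -- first differ right after `l`, where `rank g` is the smaller entry.
    cases l' with
    | nil =>
      right
      refine ⟨by simp, fun j hj => ?_⟩
      rw [List.append_nil] at hj ⊢
      rw [List.getElem?_append_left hj]
    | cons b l' =>
      left
      refine ⟨l.length, rank g, b, by simp, by simp, hmem b (by simp), fun j hj => ?_⟩
      rw [List.getElem?_append_left hj, List.getElem?_append_left hj]

/-- Well-founded recursion for choices that depend on all earlier choices. -/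
theorem exists_forall_of_wellFounded {α β : Type*} [LT α] [WellFoundedLT α]
    (Q : ∀ a : α, (∀ b, b < a → β) → β → Prop) (h : ∀ a F, ∃ b, Q a F b) :
    ∃ F : α → β, ∀ a, Q a (fun b _ => F b) (F a) := by
  choose G hG using h
  refine ⟨(wellFounded_lt (α := α)).fix G, fun a => ?_⟩
  rw [WellFounded.fix_eq]
  exact hG _ _

/-- Go up through the indeterminates `u`, choosing at each one an element of `P` with leader `u`,
reduced with respect to the earlier choices and of least degree in `u`, if there is any. No leader
chosen is a proper derivative of another, so Dickson's lemma leaves finitely many. A nonzero `g ∈ P`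
reduced with respect to all of them would compete at its own leader and contradict minimality. -/
theorem exists_isReducing {P : Ideal (DiffPoly m n K)} (hP : P ≠ ⊤) :
    ∃ Λ : Finset (DiffPoly m n K), IsReducing Λ P := by
  classical
  let cand (u : DVar m n) (F : ∀ b, b < u → Option (DiffPoly m n K)) : Set (DiffPoly m n K) :=
    {g | g ∈ P ∧ leader g = u ∧ ∀ b (hb : b < u), ∀ f, F b hb = some f → IsReduced g f}
  obtain ⟨F, hF⟩ := exists_forall_of_wellFounded
    (fun (u : DVar m n) F (o : Option (DiffPoly m n K)) =>
      (∀ f, o = some f → f ∈ cand u F ∧ ∀ g ∈ cand u F, degreeOf u f ≤ degreeOf u g) ∧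
        (o = none → ∀ g, g ∉ cand u F)) (by
    intro u F
    by_cases hne : (cand u F).Nonempty
    · have hw := (measure fun g : DiffPoly m n K => degreeOf u g).wf
      refine ⟨some (hw.min _ hne), ?_, by simp⟩
      rintro f hf
      obtain rfl : hw.min _ hne = f := by simpa using hf
      exact ⟨hw.min_mem _ hne, fun g hg => not_lt.1 (hw.not_lt_min _ hg)⟩
    · exact ⟨none, by simp, fun _ g hg => hne ⟨g, hg⟩⟩)
  have hcand : ∀ {u f}, F u = some f → f ∈ P ∧ leader f = u ∧
      ∀ b < u, ∀ f', F b = some f' → IsReduced f f' := fun {u f} hf => ((hF u).1 f hf).1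
  have hfin : {u | ∃ f, F u = some f}.Finite := by
    refine DVar.finite_of_not_isProperDerivative _ ?_
    rintro v ⟨f, hf⟩ w ⟨g, hg⟩ hwv
    have hred := (hcand hg).2.2 v hwv.lt f hf
    exact ((isReduced_iff (hcand hf).2.1).1 hred).1 w (leader_eq_coe_iff.1 (hcand hg).2.1).1 hwv
  have hmem : ∀ f, f ∈ hfin.toFinset.image (fun u => (F u).getD 0) ↔ ∃ u, F u = some f := by
    intro f
    simp only [Finset.mem_image, Set.Finite.mem_toFinset, Set.mem_ofPred_eq]
    constructor
    · rintro ⟨u, ⟨f', hf'⟩, h⟩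
      rw [hf', Option.getD_some] at h
      exact ⟨u, h ▸ hf'⟩
    · rintro ⟨u, hu⟩
      exact ⟨u, ⟨f, hu⟩, by rw [hu, Option.getD_some]⟩
  refine ⟨hfin.toFinset.image fun u => (F u).getD 0, ⟨?_, ?_⟩, ?_, ?_⟩
  · intro f hf
    obtain ⟨u, hu⟩ := (hmem f).1 hf
    exact nonempty_of_leader (hcand hu).2.1
  · intro f hf g hg hgf
    obtain ⟨u, hu⟩ := (hmem f).1 hf
    obtain ⟨w, hw⟩ := (hmem g).1 hg
    rcases lt_trichotomy u w with h | rfl | h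
    · exact (hcand hw).2.2 u h f hu
    · exact absurd (Option.some_injective _ (hw.symm.trans hu)) hgf
    · have hgw := (hcand hw).2.1
      refine (isReduced_iff (hcand hu).2.1).2 ⟨fun x hx hxu => ?_, ?_⟩
      · exact (h.trans hxu.lt).not_ge (mem_supported.1 (leader_eq_coe_iff.1 hgw).2 hx)
      · rw [degreeOf_eq_zero_of_lt_leader hgw h]
        exact degreeOf_leader_pos (hcand hu).2.1
  · intro f hf
    obtain ⟨u, hu⟩ := (hmem f).1 hf
    exact (hcand hu).1
  · intro g hg hred
    by_contra h0
    obtain ⟨u, hu⟩ := exists_leader (vars_nonempty_of_mem hP hg h0)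
    have hgc : g ∈ cand u (fun b _ => F b) :=
      ⟨hg, hu, fun b _ f hf => hred f ((hmem f).2 ⟨b, hf⟩)⟩
    cases hFu : F u with
    | none => exact (hF u).2 hFu g hgc
    | some f =>
      have h1 := ((hF u).1 f hFu).2 g hgc
      have h2 := ((isReduced_iff (hcand hFu).2.1).1 (hred f ((hmem f).2 ⟨u, hFu⟩))).2
      omega

/-- Initials and separants involve only indeterminates of `f`, in degrees no larger and strictly
smaller at the leader, so they are reduced with respect to all of `Λ`, including `f`. -/
theorem IsReducing.HProd_notMem [CharZero K] {Λ : Finset (DiffPoly m n K)}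
    {P : Ideal (DiffPoly m n K)} [hP : P.IsPrime] (h : IsReducing Λ P) : HProd Λ ∉ P := by
  have key : ∀ f ∈ Λ, ∀ v : DVar m n, leader f = v → ∀ g : DiffPoly m n K,
      (∀ s, f ∈ supported K s → g ∈ supported K s) → (∀ u, degreeOf u g ≤ degreeOf u f) →
      degreeOf v g < degreeOf v f → g ≠ 0 → g ∉ P := by
    intro f hf v hv g hs hle hlt h0 hg
    refine h0 (h.eq_zero g hg fun f' hf' => ?_)
    have hvars : ∀ w ∈ g.vars, w ∈ f.vars := fun w hw =>
      mem_supported.1 (hs _ (mem_supported_vars f)) hw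
    by_cases hff' : f' = f
    · subst hff'
      refine (isReduced_iff hv).2 ⟨fun w hw hwv => ?_, hlt⟩
      exact hwv.lt.not_ge (mem_supported.1 (leader_eq_coe_iff.1 hv).2 (hvars w hw))
    · obtain ⟨v', hv'⟩ := exists_leader (h.isAutoreduced.1 f' hf')
      have := (isReduced_iff hv').1 (h.isAutoreduced.2 f' hf' f hf (Ne.symm hff'))
      exact (isReduced_iff hv').2 ⟨fun w hw => this.1 w (hvars w hw), (hle v').trans_lt this.2⟩
  rw [HProd, hP.prod_mem_iff]
  rintro ⟨f, hf, hmem⟩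
  obtain ⟨v, hv⟩ := exists_leader (h.isAutoreduced.1 f hf)
  have hpos := degreeOf_leader_pos hv
  rcases hP.mem_or_mem hmem with hmem | hmem
  · rw [initial_of_leader hv] at hmem
    exact key f hf v hv _ (fun s => leadCoeffAt_mem_supported)
      (fun u => degreeOf_leadCoeffAt_le u v f)
      (by rwa [degreeOf_leadCoeffAt_self]) (leadCoeffAt_ne_zero hpos) hmem
  · rw [separant_of_leader hv] at hmem
    exact key f hf v hv _ (fun s => pderiv_mem_supported v) (fun u => degreeOf_pderiv_le u v f)
      (degreeOf_pderiv_self_lt hpos) (pderiv_ne_zero hpos) hmem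

end CharSet

/-! ### The quotient by a prime differential ideal over its truncation -/

section Truncation

variable {m n : ℕ} {K : Type*} [Field K]

/-- The indeterminates of order greater than `r` which are not derivatives of leaders of `Λ`
(for `Λ` of order at most `r`). -/
def freeVars (Λ : Finset (DiffPoly m n K)) (r : ℕ) : Set (DVar m n) :=
  {v | v ∈ partialVars Λ ∧ r < v.order}

theorem X_mem_orderLE {r : ℕ} {v : DVar m n} (h : v.order ≤ r) :
    (X v : DiffPoly m n K) ∈ orderLE m n K r :=
  X_mem_supported_of_mem (s := {v : DVar m n | v.order ≤ r}) h

/-- Polynomials in the free indeterminates over `K{x}_{≤ r}` as differential polynomials. -/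
def freePoly (Λ : Finset (DiffPoly m n K)) (r : ℕ) :
    MvPolynomial (freeVars Λ r) (orderLE m n K r) →+* DiffPoly m n K :=
  eval₂Hom (orderLE m n K r).subtype fun y => X (y : DVar m n)

theorem freePoly_C (Λ : Finset (DiffPoly m n K)) (r : ℕ) (c : orderLE m n K r) :
    freePoly Λ r (C c) = c := eval₂Hom_C _ _ _

theorem freePoly_X (Λ : Finset (DiffPoly m n K)) (r : ℕ) (y : freeVars Λ r) :
    freePoly Λ r (X y) = X (y : DVar m n) := eval₂Hom_X' _ _ _

open Classical in
/-- The retraction of `freePoly` killing all other indeterminates. -/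
def freeRetraction (Λ : Finset (DiffPoly m n K)) (r : ℕ) :
    DiffPoly m n K →ₐ[K] MvPolynomial (freeVars Λ r) (orderLE m n K r) :=
  aeval fun v => if h : v.order ≤ r then C ⟨X v, X_mem_orderLE h⟩ else
    if h : v ∈ freeVars Λ r then X ⟨v, h⟩ else 0

theorem freeRetraction_orderLE (Λ : Finset (DiffPoly m n K)) (r : ℕ) {f : DiffPoly m n K}
    (hf : f ∈ orderLE m n K r) : freeRetraction Λ r f = C ⟨f, hf⟩ := by
  unfold orderLE supported at hf
  induction hf using Algebra.adjoin_induction with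
  | mem x hx =>
    obtain ⟨w, hw, rfl⟩ := hx
    rw [freeRetraction, aeval_X]
    exact dif_pos hw
  | algebraMap a => exact AlgHom.commutes _ _
  | add p q hp' hq' hp hq =>
    rw [map_add, hp, hq, ← map_add]
    rfl
  | mul p q hp' hq' hp hq =>
    rw [map_mul, hp, hq, ← map_mul]
    rfl

theorem freeRetraction_freePoly (Λ : Finset (DiffPoly m n K)) (r : ℕ)
    (q : MvPolynomial (freeVars Λ r) (orderLE m n K r)) :
    freeRetraction Λ r (freePoly Λ r q) = q := by
  induction q using MvPolynomial.induction_on with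
  | C c => rw [freePoly_C, freeRetraction_orderLE Λ r c.2]
  | add p q hp hq => rw [map_add, map_add, hp, hq]
  | mul_X p y hp =>
    rw [map_mul, map_mul, hp, freePoly_X, freeRetraction, aeval_X,
      dif_neg (not_le.2 y.2.2), dif_pos y.2]

theorem freePoly_mem_supported (Λ : Finset (DiffPoly m n K)) (r : ℕ)
    (q : MvPolynomial (freeVars Λ r) (orderLE m n K r)) :
    freePoly Λ r q ∈ supported K ({v | v.order ≤ r} ∪ partialVars Λ) := by
  induction q using MvPolynomial.induction_on with
  | C c =>
    rw [freePoly_C]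
    exact supported_mono Set.subset_union_left c.2
  | add p q hp hq => rw [map_add]; exact Subalgebra.add_mem _ hp hq
  | mul_X p y hp =>
    rw [map_mul, freePoly_X]
    exact Subalgebra.mul_mem _ hp (X_mem_supported_of_mem (Or.inr y.2.1))

theorem exists_freePoly_eq {Λ : Finset (DiffPoly m n K)} (r : ℕ) {g : DiffPoly m n K}
    (hg : g ∈ supported K (partialVars Λ)) : ∃ q, freePoly Λ r q = g := by
  rw [supported] at hg
  induction hg using Algebra.adjoin_induction with
  | mem x hx =>
    obtain ⟨w, hw, rfl⟩ := hx
    by_cases h : w.order ≤ r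
    · exact ⟨C ⟨X w, X_mem_orderLE h⟩, freePoly_C _ _ _⟩
    · exact ⟨X ⟨w, hw, not_le.1 h⟩, freePoly_X _ _ _⟩
  | algebraMap a => exact ⟨C (algebraMap K _ a), freePoly_C _ _ _⟩
  | add p q _ _ hp hq =>
    obtain ⟨p', rfl⟩ := hp
    obtain ⟨q', rfl⟩ := hq
    exact ⟨p' + q', map_add _ _ _⟩
  | mul p q _ _ hp hq =>
    obtain ⟨p', rfl⟩ := hp
    obtain ⟨q', rfl⟩ := hq
    exact ⟨p' * q', map_mul _ _ _⟩

variable [DiffRing m K]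

/-- The generators of `truncSpan Λ r` lie in `K{x}_{≤ r}`, which the retraction sends to constants.
This brings a relation in the full ring back to `K{x}_{≤ r}`. -/
theorem freeRetraction_mem_map {Λ : Finset (DiffPoly m n K)} {r : ℕ} {g : DiffPoly m n K}
    (hg : g ∈ truncSpan Λ r) : freeRetraction Λ r g ∈ (truncIdeal Λ r).map C := by
  have : truncSpan Λ r ≤ ((truncIdeal Λ r).map C).comap (freeRetraction Λ r) := by
    rw [truncSpan, Ideal.span_le]
    rintro g ⟨hg, ξ, f, hf, hgf⟩
    rw [SetLike.mem_coe, Ideal.mem_comap, freeRetraction_orderLE Λ r hg]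
    exact Ideal.mem_map_of_mem _ (Ideal.subset_span ⟨ξ, f, hf, hgf⟩)
  exact this hg

theorem IsReducing.exists_HProd_pow_mul_mem {Λ : Finset (DiffPoly m n K)}
    {P : Ideal (DiffPoly m n K)} (h : IsReducing Λ P) (hP : IsDiffIdeal m P) {r : ℕ}
    (hr : ∀ f ∈ Λ, f ∈ orderLE m n K r) {g : DiffPoly m n K} (hg : g ∈ P)
    (hgr : g ∈ supported K ({v | v.order ≤ r} ∪ partialVars Λ)) :
    ∃ l : ℕ, HProd Λ ^ l * g ∈ truncSpan Λ r := by
  obtain ⟨a, ha, g', hI, hred⟩ := h.isAutoreduced.exists_reduction hr hgr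
  have hg' : g' ∈ P := by
    have := P.sub_mem (P.mul_mem_left a hg) (truncSpan_le hP h.mem r hI)
    rwa [sub_sub_cancel] at this
  rw [h.eq_zero g' hg' hred, sub_zero] at hI
  obtain ⟨b, -, l, hl⟩ := exists_mul_eq_HProd_pow ha
  refine ⟨l, ?_⟩
  rw [← hl, mul_comm a, mul_assoc]
  exact Ideal.mul_mem_left _ _ hI

/-- This yields algebraic independence of the free indeterminates: after retraction, membership in
the extended ideal can be tested coefficient by coefficient. -/
theorem IsReducing.coeff_mem_saturation {Λ : Finset (DiffPoly m n K)}
    {P : Ideal (DiffPoly m n K)} (h : IsReducing Λ P) (hP : IsDiffIdeal m P) {r : ℕ}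
    (hr : ∀ f ∈ Λ, f ∈ orderLE m n K r)
    {q : MvPolynomial (freeVars Λ r) (orderLE m n K r)} (hq : freePoly Λ r q ∈ P)
    (s : freeVars Λ r →₀ ℕ) :
    coeff s q ∈ saturation (truncIdeal Λ r) (HTrunc Λ r hr) := by
  obtain ⟨l, hl⟩ := h.exists_HProd_pow_mul_mem hP hr hq (freePoly_mem_supported Λ r q)
  have h1 := freeRetraction_mem_map hl
  rw [map_mul, map_pow, freeRetraction_freePoly, freeRetraction_orderLE Λ r (HProd_mem hr),
    ← map_pow] at h1
  have h2 := mem_map_C_iff.1 h1 s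
  rw [coeff_C_mul] at h2
  exact ⟨l, h2⟩

theorem IsReducing.saturation_eq [CharZero K] {Λ : Finset (DiffPoly m n K)}
    {P : Ideal (DiffPoly m n K)} [hPp : P.IsPrime] (h : IsReducing Λ P) (hP : IsDiffIdeal m P)
    {r : ℕ} (hr : ∀ f ∈ Λ, f ∈ orderLE m n K r) :
    saturation (truncIdeal Λ r) (HTrunc Λ r hr) = P.comap (orderLE m n K r).subtype := by
  apply le_antisymm
  · rintro f ⟨l, hl⟩
    have hle : truncIdeal Λ r ≤ P.comap (orderLE m n K r).subtype := by
      rw [truncIdeal, Ideal.span_le]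
      rintro g ⟨ξ, f, hf, hg⟩
      exact Ideal.mem_comap.2 ((show (orderLE m n K r).subtype g = _ from hg) ▸
        iterDer_mem hP (h.mem f hf) ξ)
    have h1 := Ideal.mem_comap.1 (hle hl)
    rw [map_mul, map_pow] at h1
    exact (hPp.mem_or_mem h1).resolve_left fun h2 => h.HProd_notMem (hPp.mem_of_pow_mem _ h2)
  · intro f hf
    have h1 := h.coeff_mem_saturation hP hr (q := C f) (by rw [freePoly_C]; exact hf) 0
    rwa [coeff_zero_C] at h1

theorem IsReducing.exists_freePoly_sub_mem {Λ : Finset (DiffPoly m n K)}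
    {P : Ideal (DiffPoly m n K)} (h : IsReducing Λ P) (hP : IsDiffIdeal m P) (r : ℕ)
    (g : DiffPoly m n K) : ∃ (l : ℕ) (q : _), HProd Λ ^ l * g - freePoly Λ r q ∈ P := by
  -- The order bound here is that of `g`, unrelated to `r`: derivatives of `Λ` of any order may be
  -- used, since only congruence modulo `P` is claimed.
  have hg : g ∈ supported K ({v : DVar m n | v.order ≤ g.vars.sup DVar.order} ∪ partialVars Λ) :=
    mem_supported.2 fun w hw => Or.inl (Finset.le_sup (f := DVar.order) hw)
  obtain ⟨a, ha, g', hg', hI⟩ := h.isAutoreduced.exists_partial_reduction _ hg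
  obtain ⟨b, hb, l, hl⟩ := exists_mul_eq_HProd_pow ha
  obtain ⟨q, hq⟩ := exists_freePoly_eq r
    (Subalgebra.mul_mem _ (h.isAutoreduced.initSepMonoid_le hb) hg')
  refine ⟨l, q, ?_⟩
  rw [hq, ← hl]
  convert P.mul_mem_left b (truncSpan_le hP h.mem _ hI) using 1
  ring

/-- Up to powers of `H_Λ`, the quotient `S` of `K{x}` by a prime differential ideal is a
polynomial ring over the image `R` of `K{x}_{≤ r}`. -/
theorem IsReducing.eval₂Hom_injective_and_exists [CharZero K] {Λ : Finset (DiffPoly m n K)}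
    {P : Ideal (DiffPoly m n K)} [P.IsPrime] (h : IsReducing Λ P) (hP : IsDiffIdeal m P)
    {r : ℕ} (hr : ∀ f ∈ Λ, f ∈ orderLE m n K r) {R S : Type*} [CommRing R] [CommRing S]
    {α : orderLE m n K r →+* R} (hα : Function.Surjective α)
    {β : DiffPoly m n K →+* S} (hβ : Function.Surjective β) (hker : RingHom.ker β = P)
    {j : R →+* S} (hj : Function.Injective j) (hjα : ∀ f, j (α f) = β f) :
    Function.Injective (eval₂Hom j fun y : freeVars Λ r => β (X (y : DVar m n))) ∧
      ∀ s, ∃ (l : ℕ) (p : MvPolynomial (freeVars Λ r) R),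
        β (HProd Λ) ^ l * s = eval₂Hom j (fun y : freeVars Λ r => β (X (y : DVar m n))) p := by
  have hcomp : ∀ q, eval₂Hom j (fun y : freeVars Λ r => β (X (y : DVar m n))) (map α q) =
      β (freePoly Λ r q) := by
    intro q
    rw [coe_eval₂Hom, eval₂_map, freePoly, coe_eval₂Hom, hom_eval₂]
    congr 1
    exact RingHom.ext hjα
  refine ⟨(injective_iff_map_eq_zero _).2 fun p hp => ?_, fun s => ?_⟩
  · obtain ⟨q, rfl⟩ := map_surjective α hα p
    rw [hcomp, ← RingHom.mem_ker, hker] at hp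
    ext s
    have h1 := h.coeff_mem_saturation hP hr hp s
    rw [h.saturation_eq hP hr, Ideal.mem_comap, ← hker, RingHom.mem_ker] at h1
    rw [coeff_map, coeff_zero]
    exact hj (by rw [hjα, map_zero]; exact h1)
  · obtain ⟨g, rfl⟩ := hβ s
    obtain ⟨l, q, hq⟩ := h.exists_freePoly_sub_mem hP r g
    refine ⟨l, map α q, ?_⟩
    rw [← hker, RingHom.mem_ker, map_sub, sub_eq_zero, map_mul, map_pow] at hq
    rw [hcomp, hq]

end Truncation

/-! ### Localisation and existential closedness -/

section Localization

attribute [local instance] MvPolynomial.algebraMvPolynomial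

/-- Both rings are localisations of the polynomial ring over `R` at the constant `h`: evaluation
embeds that ring in `S` and reaches every element up to a power of `h'`. -/
theorem exists_localization_algEquiv {K R S ι : Type*} [CommRing K] [CommRing R] [CommRing S]
    [IsDomain S] [Algebra K R] [Algebra K S] (j : R →ₐ[K] S) (x : ι → S)
    (hinj : Function.Injective (eval₂Hom (j : R →+* S) x)) (h : R) {h' : S} (hh : j h = h')
    (h0 : h' ≠ 0)
    (hsurj : ∀ s, ∃ (l : ℕ) (p : MvPolynomial ι R), h' ^ l * s = eval₂Hom (j : R →+* S) x p) :
    ∃ e : MvPolynomial ι (Localization.Away h) ≃ₐ[K] Localization.Away h',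
      ∀ a : R, e (C (algebraMap R (Localization.Away h) a)) = algebraMap S _ (j a) := by
  have hC : ∀ a, eval₂Hom (j : R →+* S) x (C a) = j a := fun a => eval₂Hom_C _ _ _
  generalize hψ : eval₂Hom (j : R →+* S) x = ψ at *
  let _ : Algebra (MvPolynomial ι R) (Localization.Away h') :=
    ((algebraMap S (Localization.Away h')).comp ψ).toAlgebra
  have hmap : ∀ p, algebraMap (MvPolynomial ι R) (Localization.Away h') p =
      algebraMap S (Localization.Away h') (ψ p) := fun _ => rfl
  have hinj' : Function.Injective (algebraMap S (Localization.Away h')) :=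
    IsLocalization.injective _ (powers_le_nonZeroDivisors_of_noZeroDivisors h0)
  have hunit : IsUnit (algebraMap S (Localization.Away h') h') :=
    IsLocalization.Away.algebraMap_isUnit h'
  have h1 : IsLocalization.Away (C h : MvPolynomial ι R) (Localization.Away h') := by
    refine ⟨?_, ?_, ?_⟩
    · rintro ⟨_, l, rfl⟩
      change IsUnit (algebraMap _ _ ((C h : MvPolynomial ι R) ^ l))
      rw [hmap, map_pow, hC, hh, map_pow]
      exact hunit.pow l
    · intro z
      obtain ⟨l, s, hs⟩ := IsLocalization.Away.surj h' z
      obtain ⟨k, p, hp⟩ := hsurj s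
      refine ⟨(p, ⟨C h ^ (k + l), k + l, rfl⟩), ?_⟩
      change z * algebraMap _ _ ((C h : MvPolynomial ι R) ^ (k + l)) = _
      rw [hmap, hmap, map_pow, hC, hh, ← hp, map_mul, ← hs, map_pow, map_pow]
      ring
    · intro a b hab
      rw [hmap, hmap] at hab
      exact ⟨1, by rw [hinj (hinj' hab)]⟩
  have h2 : IsLocalization.Away (C h : MvPolynomial ι R)
      (MvPolynomial ι (Localization.Away h)) := by
    have := MvPolynomial.isLocalization (σ := ι) (Submonoid.powers h) (Localization.Away h)
    rwa [Submonoid.map_powers] at this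
  let e := IsLocalization.algEquiv (Submonoid.powers (C h : MvPolynomial ι R))
    (MvPolynomial ι (Localization.Away h)) (Localization.Away h')
  have he : ∀ a : R, e (C (algebraMap R (Localization.Away h) a)) = algebraMap S _ (j a) := by
    intro a
    have h3 : (C (algebraMap R (Localization.Away h) a) : MvPolynomial ι (Localization.Away h)) =
        algebraMap (MvPolynomial ι R) _ (C a) := (map_C _ _).symm
    rw [h3, AlgEquiv.commutes, hmap, hC]
  refine ⟨AlgEquiv.ofRingEquiv (f := e.toRingEquiv) fun c => ?_, he⟩
  have h4 := he (algebraMap K R c)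
  rw [AlgHom.commutes, ← IsScalarTower.algebraMap_apply,
    ← IsScalarTower.algebraMap_apply] at h4
  exact h4

theorem isExistentiallyClosed_of_polynomial {F L ι : Type*} [Field F] [Infinite F] [Field L]
    (φ : F →+* L) (x : ι → L) (hinj : Function.Injective (eval₂Hom φ x))
    (hfrac : ∀ z, ∃ a b, eval₂Hom φ x b ≠ 0 ∧ z * eval₂Hom φ x b = eval₂Hom φ x a) :
    IsExistentiallyClosed φ := by
  rintro N E ⟨z, hz⟩
  have hC : ∀ a, eval₂Hom φ x (C a) = φ a := fun a => eval₂Hom_C _ _ _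
  generalize hψ : eval₂Hom φ x = ψ at *
  choose a b hb hab using fun i => hfrac (z i)
  have hprod : ψ (∏ i, b i) ≠ 0 := by
    rw [map_prod]
    exact Finset.prod_ne_zero_iff.2 fun i _ => hb i
  -- Over an infinite field a nonzero polynomial has a point of nonvanishing; specialising there is
  -- defined on all the coordinates `a i / b i`.
  obtain ⟨y, hy⟩ : ∃ y : ι → F, eval y (∏ i, b i) ≠ 0 := by
    by_contra! hall
    refine hprod ?_
    rw [MvPolynomial.funext (p := ∏ i, b i) (q := 0) fun y => by rw [hall y, map_zero], map_zero]
  set B := Localization.Away (∏ i, b i)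
  let ψ' : B →+* L := IsLocalization.Away.lift (∏ i, b i) (g := ψ) hprod.isUnit
  let ev : B →+* F := IsLocalization.Away.lift (∏ i, b i) (g := eval y) hy.isUnit
  have hψ' : ∀ p, ψ' (algebraMap _ B p) = ψ p := fun p => IsLocalization.Away.lift_eq _ _ p
  have hev : ∀ p, ev (algebraMap _ B p) = eval y p := fun p => IsLocalization.Away.lift_eq _ _ p
  have hψinj : Function.Injective ψ' := by
    refine (IsLocalization.lift_injective_iff (M := Submonoid.powers (∏ i, b i)) _).2 fun p q => ?_
    have h0 : (∏ i, b i) ≠ 0 := fun h0 => hprod (by rw [h0, map_zero])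
    rw [(IsLocalization.injective B (powers_le_nonZeroDivisors_of_noZeroDivisors h0)).eq_iff,
      hinj.eq_iff]
  have hbu : ∀ i, IsUnit (algebraMap _ B (b i)) := fun i =>
    isUnit_of_dvd_unit (map_dvd _ (Finset.dvd_prod_of_mem b (Finset.mem_univ i)))
      (IsLocalization.Away.algebraMap_isUnit (∏ i, b i))
  choose c hc using fun i => (hbu i).exists_right_inv
  have hzc : ∀ i, ψ' (algebraMap _ B (a i) * c i) = z i := by
    intro i
    have h1 : ψ' (c i) * ψ (b i) = 1 := by rw [← hψ', ← map_mul, mul_comm, hc, map_one]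
    rw [map_mul, hψ', ← hab, mul_assoc, mul_comm (ψ (b i)), h1, mul_one]
  refine ⟨fun i => ev (algebraMap _ B (a i) * c i), fun p hp => ?_⟩
  -- The equations already hold in the localisation, because it embeds in `L`; applying `ev` carries
  -- them to `F`.
  have h1 : eval₂ ((algebraMap (MvPolynomial ι F) B).comp C)
      (fun i => algebraMap (MvPolynomial ι F) B (a i) * c i) p = 0 := by
    refine hψinj ?_
    rw [hom_eval₂, map_zero, ← hz p hp]
    congr 1
    · exact RingHom.ext fun t => (hψ' _).trans (hC t)
    · exact funext hzc
  have h2 := congrArg ev h1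
  rw [hom_eval₂, map_zero] at h2
  rw [← h2]
  change eval₂ _ _ _ = _
  congr 1
  exact RingHom.ext fun t => ((hev _).trans (eval_C _)).symm

theorem exists_isExistentiallyClosed {R S ι : Type*} [CommRing R] [IsDomain R] [Infinite R]
    [CommRing S] [IsDomain S] (j : R →+* S) (x : ι → S)
    (hinj : Function.Injective (eval₂Hom j x)) (h : R) {h' : S} (hh : j h = h')
    (h0 : h' ≠ 0)
    (hsurj : ∀ s, ∃ (l : ℕ) (p : MvPolynomial ι R), h' ^ l * s = eval₂Hom j x p) :
    ∃ φ : FractionRing R →+* FractionRing S,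
      (∀ a, φ (algebraMap R _ a) = algebraMap S _ (j a)) ∧ IsExistentiallyClosed φ := by
  subst hh
  have hC : ∀ a, eval₂Hom j x (C a) = j a := fun a => eval₂Hom_C _ _ _
  have hj : Function.Injective j := fun a b hab => C_injective ι R (hinj (by rw [hC, hC, hab]))
  have hSinj := IsFractionRing.injective S (FractionRing S)
  let φ : FractionRing R →+* FractionRing S :=
    IsFractionRing.lift (g := (algebraMap S (FractionRing S)).comp j) (hSinj.comp hj)
  have hφ : ∀ a, φ (algebraMap R _ a) = algebraMap S _ (j a) := fun a =>
    IsFractionRing.lift_algebraMap _ a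
  have hmap : ∀ p, eval₂Hom φ (fun i => algebraMap S (FractionRing S) (x i))
      (map (algebraMap R (FractionRing R)) p) = algebraMap S _ (eval₂Hom j x p) := by
    intro p
    rw [coe_eval₂Hom, eval₂_map, coe_eval₂Hom, hom_eval₂]
    congr 1
    exact RingHom.ext hφ
  have : Infinite (FractionRing R) :=
    Infinite.of_injective _ (IsFractionRing.injective R (FractionRing R))
  refine ⟨φ, hφ, isExistentiallyClosed_of_polynomial φ (fun i => algebraMap S _ (x i))
    ((injective_iff_map_eq_zero _).2 fun p hp => ?_) fun z => ?_⟩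
  -- Clearing the denominators of the coefficients reduces injectivity over `Frac R` to injectivity
  -- over `R`.
  · obtain ⟨⟨q, ⟨_, d, hd, rfl⟩⟩, hq⟩ := IsLocalization.surj
      ((nonZeroDivisors R).map (C (σ := ι))) p
    change p * map (algebraMap R (FractionRing R)) (C d) = map (algebraMap R _) q at hq
    have h1 : map (algebraMap R (FractionRing R)) q = 0 := by
      have h2 : algebraMap S (FractionRing S) (eval₂Hom j x q) = 0 := by
        rw [← hmap, ← hq, map_mul, hp, zero_mul]
      rw [hinj ((hSinj (h2.trans (map_zero _).symm)).trans (map_zero _).symm), map_zero]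
    rw [h1, map_C] at hq
    refine (mul_eq_zero.1 hq).resolve_right fun h3 => ?_
    rw [C_eq_zero] at h3
    exact nonZeroDivisors.ne_zero hd
      (IsFractionRing.injective R (FractionRing R) (h3.trans (map_zero _).symm))
  · obtain ⟨s, t, ht, rfl⟩ := IsFractionRing.div_surjective (A := S) z
    have ht0 := nonZeroDivisors.ne_zero ht
    obtain ⟨k, p, hp⟩ := hsurj s
    obtain ⟨l, q, hq⟩ := hsurj t
    have hval : eval₂Hom j x (C h ^ k * q) = j h ^ (k + l) * t := by
      rw [map_mul, map_pow, hC, ← hq, pow_add, mul_assoc]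
    have hne : algebraMap S (FractionRing S) (j h ^ (k + l) * t) ≠ 0 := fun h1 =>
      mul_ne_zero (pow_ne_zero _ h0) ht0 (hSinj (h1.trans (map_zero _).symm))
    refine ⟨map (algebraMap R _) (C h ^ l * p), map (algebraMap R _) (C h ^ k * q), ?_, ?_⟩
    · rwa [hmap, hval]
    · have ht' : algebraMap S (FractionRing S) t ≠ 0 := fun h1 =>
        ht0 (hSinj (h1.trans (map_zero _).symm))
      rw [hmap, hmap, hval, map_mul (eval₂Hom j x), map_pow (eval₂Hom j x), hC, ← hp,
        div_mul_eq_mul_div, div_eq_iff ht', ← map_mul, ← map_mul]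
      congr 1
      ring

end Localization

/-! ### Differential algebras as quotients of differential polynomial rings -/

section Evaluation

variable {m n : ℕ} {K B : Type*} [Field K] [CommRing B] [Algebra K B]
  [DiffRing m B]

/-- Evaluation of differential polynomials at a tuple in a differential algebra. -/
def diffAeval (b : Fin n → B) : DiffPoly m n K →ₐ[K] B :=
  aeval fun v : DVar m n => iterDer v.exp (b v.idx)

theorem diffAeval_X (b : Fin n → B) (v : DVar m n) :
    diffAeval b (X v : DiffPoly m n K) = iterDer v.exp (b v.idx) := aeval_X _ _

theorem diffAeval_der [DiffRing m K] [DiffAlgebra m K B] (b : Fin n → B) (k : Fin m)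
    (f : DiffPoly m n K) :
    diffAeval b (DiffRing.der k f) = DiffRing.der k (diffAeval b f) := by
  induction f using MvPolynomial.induction_on with
  | C a =>
    rw [der_C]
    exact ((diffAeval b).commutes _).trans
      ((DiffAlgebra.der_algebraMap k a).symm.trans (congrArg _ ((diffAeval b).commutes a).symm))
  | add p q hp hq => rw [map_add, map_add, hp, hq, map_add, map_add]
  | mul_X p v hp =>
    rw [der_mul, der_X, map_add, map_mul, map_mul, hp, map_mul, Derivation.leibniz, diffAeval_X,
      diffAeval_X, ← iterDer_add_single]
    rfl

theorem exists_diffAeval_surjective (h : DiffFinGen m K B) :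
    ∃ (n : ℕ) (b : Fin n → B),
      Function.Surjective (diffAeval b : DiffPoly m n K →ₐ[K] B) := by
  obtain ⟨s, hs⟩ := h
  refine ⟨s.card, fun i => s.equivFin.symm i, ?_⟩
  rw [← AlgHom.range_eq_top, eq_top_iff, ← hs, Algebra.adjoin_le_iff]
  rintro _ ⟨ξ, b, hb, rfl⟩
  refine ⟨X ⟨ξ, s.equivFin ⟨b, hb⟩⟩, ?_⟩
  exact (diffAeval_X _ _).trans (by rw [Equiv.symm_apply_apply])

theorem orderLE_fg (m n : ℕ) (K : Type*) [CommRing K] (r : ℕ) : (orderLE m n K r).FG :=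
  Subalgebra.fg_def.2 ⟨_, (DVar.finite_order_le r).image X, rfl⟩

theorem exists_orderLE (Λ : Finset (DiffPoly m n K)) :
    ∃ r, ∀ f ∈ Λ, f ∈ orderLE m n K r := by
  refine ⟨Λ.sup fun f => f.vars.sup DVar.order, fun f hf => mem_supported.2 fun w hw => ?_⟩
  exact (Finset.le_sup (f := DVar.order) hw).trans
    (Finset.le_sup (f := fun f : DiffPoly m n K => f.vars.sup DVar.order) hf)

end Evaluation

/-! ### The structure theorem -/

section Structure

variable {m : ℕ} {K : Type u} [Field K] [CharZero K] [DiffRing m K]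

/-- The subalgebra `A` is the image of `K{x}_{≤ r}`, finitely generated because only finitely many
indeterminates have order at most `r`; `h` is the image of `H_Λ`. -/
theorem exists_structure {B : Type v} [CommRing B] [IsDomain B] [Algebra K B] [DiffRing m B]
    [DiffAlgebra m K B] (hB : DiffFinGen m K B) :
    ∃ A : Subalgebra K B, A.FG ∧ ∃ h : A, h ≠ 0 ∧
      ∃ (ι : Type) (e : Localization.Away (h : B) ≃ₐ[K]
          Localization.Away h ⊗[K] MvPolynomial ι K),
        ∀ a : A, e (algebraMap B (Localization.Away (h : B)) (a : B)) =
          algebraMap A (Localization.Away h) a ⊗ₜ[K] 1 := by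
  obtain ⟨n, b, hb⟩ := exists_diffAeval_surjective hB
  set φ : DiffPoly m n K →ₐ[K] B := diffAeval b with hφ
  set P := RingHom.ker (φ : DiffPoly m n K →+* B) with hPdef
  have hPp : P.IsPrime := RingHom.ker_isPrime _
  have hP : IsDiffIdeal m P := by
    intro k f hf
    have hf' : φ f = 0 := hf
    change φ (DiffRing.der k f) = 0
    rw [hφ, diffAeval_der, ← hφ, hf', map_zero]
  obtain ⟨Λ, hΛ⟩ := exists_isReducing hPp.ne_top
  obtain ⟨r, hr⟩ := exists_orderLE Λ
  have hmem : ∀ f : orderLE m n K r, φ f ∈ (orderLE m n K r).map φ := fun f => ⟨f, f.2, rfl⟩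
  let α : orderLE m n K r →+* (orderLE m n K r).map φ :=
    ((φ.comp (orderLE m n K r).val).codRestrict _ hmem : _ →ₐ[K] _)
  have hα : Function.Surjective α := by
    rintro ⟨_, f, hf, rfl⟩
    exact ⟨⟨f, hf⟩, rfl⟩
  obtain ⟨hinj, hsurj⟩ := hΛ.eval₂Hom_injective_and_exists hP hr hα
    (β := (φ : DiffPoly m n K →+* B)) hb rfl
    (j := (((orderLE m n K r).map φ).val : _ →+* B)) Subtype.val_injective fun _ => rfl
  have h0 : φ (HProd Λ) ≠ 0 := hΛ.HProd_notMem
  let h : (orderLE m n K r).map φ := ⟨φ (HProd Λ), HProd Λ, HProd_mem hr, rfl⟩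
  obtain ⟨e, he⟩ := exists_localization_algEquiv ((orderLE m n K r).map φ).val _ hinj h
    (h' := (h : B)) rfl h0 hsurj
  refine ⟨(orderLE m n K r).map φ, (orderLE_fg m n K r).map φ, h,
    fun h1 => h0 (congrArg Subtype.val h1), freeVars Λ r,
    e.symm.trans ((algebraTensorAlgEquiv K (Localization.Away h)).symm.restrictScalars K),
    fun a => ?_⟩
  have h1 : e.symm (algebraMap B (Localization.Away (h : B)) (a : B)) =
      C (algebraMap _ (Localization.Away h) a) := e.symm_apply_eq.2 (he a).symm
  refine (congrArg (algebraTensorAlgEquiv K (Localization.Away h)).symm h1).trans ?_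
  rw [AlgEquiv.symm_apply_eq]
  simp [Algebra.smul_def]

theorem IsReducing.exists_truncQuot_embedding {n : ℕ} {P : Ideal (DiffPoly m n K)} [P.IsPrime]
    {Λ : Finset (DiffPoly m n K)} (hΛ : IsReducing Λ P) (hP : IsDiffIdeal m P) {r : ℕ}
    (hr : ∀ f ∈ Λ, f ∈ orderLE m n K r) :
    ∃ j : TruncQuot Λ r hr →ₐ[K] DiffPoly m n K ⧸ P, Function.Injective j ∧
      ∀ f : orderLE m n K r, j (truncMk Λ r hr f) = Ideal.Quotient.mk P (f : DiffPoly m n K) := by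
  have hsat := hΛ.saturation_eq hP hr
  refine ⟨Ideal.Quotient.liftₐ _ ((Ideal.Quotient.mkₐ K P).comp (orderLE m n K r).val)
    fun f hf => ?_, ?_, fun _ => rfl⟩
  · rw [hsat] at hf
    exact Ideal.Quotient.eq_zero_iff_mem.2 hf
  · refine (injective_iff_map_eq_zero _).2 fun x hx => ?_
    obtain ⟨f, rfl⟩ := Ideal.Quotient.mk_surjective x
    refine Ideal.Quotient.eq_zero_iff_mem.2 ?_
    rw [hsat]
    exact Ideal.mem_comap.2 (Ideal.Quotient.eq_zero_iff_mem.1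
      (show Ideal.Quotient.mk P (f : DiffPoly m n K) = 0 from hx))

end Structure

end DiffAlg

end

theorem theorem4p15 (m : ℕ) (K : Type u) [Field K] [CharZero K] [DiffAlg.DiffRing m K] :
    -- the structure theorem
    (∀ (B : Type v) [CommRing B] [IsDomain B] [Algebra K B] [DiffAlg.DiffRing m B]
        [DiffAlg.DiffAlgebra m K B], DiffAlg.DiffFinGen m K B →
      ∃ A : Subalgebra K B, A.FG ∧ ∃ h : A, h ≠ 0 ∧
        ∃ (ι : Type) (e : Localization.Away (h : B) ≃ₐ[K]
            Localization.Away h ⊗[K] MvPolynomial ι K),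
          ∀ a : A, e (algebraMap B (Localization.Away (h : B)) (a : B)) =
            algebraMap A (Localization.Away h) a ⊗ₜ[K] 1) ∧
    -- localising at `H_Λ` for a characteristic set `Λ` of a prime differential ideal `P`
    (∀ (n : ℕ) (P : Ideal (DiffAlg.DiffPoly m n K)) [P.IsPrime], DiffAlg.IsDiffIdeal m P →
      ∀ Λ : Finset (DiffAlg.DiffPoly m n K), DiffAlg.IsCharSet Λ P →
      ∀ (r : ℕ) (hΛ : ∀ f ∈ Λ, f ∈ DiffAlg.orderLE m n K r),
        -- the localised quotient is a polynomial algebra over the localised truncated quotient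
        (∃ (ι : Type)
            (e : MvPolynomial ι (Localization.Away
                (DiffAlg.truncMk Λ r hΛ (DiffAlg.HTrunc Λ r hΛ))) ≃ₐ[K]
              Localization.Away (Ideal.Quotient.mk P (DiffAlg.HProd Λ))),
          ∀ f : DiffAlg.orderLE m n K r,
            e (MvPolynomial.C (algebraMap _ _ (DiffAlg.truncMk Λ r hΛ f))) =
              algebraMap _ _ (Ideal.Quotient.mk P (f : DiffAlg.DiffPoly m n K))) ∧
        -- the fraction field of the truncated quotient is existentially closed in that of `K{x}/P`
        ∃ _ : IsDomain (DiffAlg.TruncQuot Λ r hΛ),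
          ∃ φ : FractionRing (DiffAlg.TruncQuot Λ r hΛ) →+*
              FractionRing (DiffAlg.DiffPoly m n K ⧸ P),
            (∀ f : DiffAlg.orderLE m n K r,
              φ (algebraMap _ _ (DiffAlg.truncMk Λ r hΛ f)) =
                algebraMap _ _ (Ideal.Quotient.mk P (f : DiffAlg.DiffPoly m n K))) ∧
            DiffAlg.IsExistentiallyClosed φ) := by
  refine ⟨fun B _ _ _ _ _ hB => DiffAlg.exists_structure hB, ?_⟩
  intro n P hPp hP Λ hchar r hΛ
  have hred := hchar.isReducing hPp.ne_top
  obtain ⟨j, hj, hjmk⟩ := hred.exists_truncQuot_embedding hP hΛ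
  obtain ⟨hinj, hsurj⟩ := hred.eval₂Hom_injective_and_exists hP hΛ
    (α := DiffAlg.truncMk Λ r hΛ) Ideal.Quotient.mk_surjective
    (β := Ideal.Quotient.mk P) Ideal.Quotient.mk_surjective Ideal.mk_ker
    (j := (j : _ →+* DiffAlg.DiffPoly m n K ⧸ P)) hj hjmk
  have hH : j (DiffAlg.truncMk Λ r hΛ (DiffAlg.HTrunc Λ r hΛ)) =
      Ideal.Quotient.mk P (DiffAlg.HProd Λ) := hjmk _
  have h0 : Ideal.Quotient.mk P (DiffAlg.HProd Λ) ≠ 0 := fun h =>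
    hred.HProd_notMem (Ideal.Quotient.eq_zero_iff_mem.1 h)
  have hdom : IsDomain (DiffAlg.TruncQuot Λ r hΛ) := Function.Injective.isDomain j.toRingHom hj
  -- A field of characteristic 0 is infinite, and it embeds in `R`; the specialisation argument
  -- needs this.
  have hinf : Infinite (DiffAlg.TruncQuot Λ r hΛ) :=
    Infinite.of_injective _ (algebraMap K (DiffAlg.TruncQuot Λ r hΛ)).injective
  refine ⟨?_, hdom, ?_⟩
  · obtain ⟨e, he⟩ := DiffAlg.exists_localization_algEquiv j _ hinj _ hH h0 hsurj
    exact ⟨DiffAlg.freeVars Λ r, e, fun f => (he _).trans (congrArg _ (hjmk f))⟩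
  · obtain ⟨φ, hφ, hec⟩ := DiffAlg.exists_isExistentiallyClosed
      (j : DiffAlg.TruncQuot Λ r hΛ →+* DiffAlg.DiffPoly m n K ⧸ P) _ hinj
      (DiffAlg.truncMk Λ r hΛ (DiffAlg.HTrunc Λ r hΛ)) hH h0 hsurj
    exact ⟨φ, fun f => (hφ _).trans (congrArg
      (algebraMap (DiffAlg.DiffPoly m n K ⧸ P) (FractionRing (DiffAlg.DiffPoly m n K ⧸ P)))
      (hjmk f)), hec⟩
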